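/- Let $d \ge 2$ and consider the lattice $\mathbb{Z}^d$, in which two vertices are joined by an edge when their $\ell^1$ distance is $1$. Let the edges $e$ carry real-valued passage times $t(e)$ that are random variables on a common probability space $(\Omega,\mathcal{F},\mathbb{P})$, independent and identically distributed with common law $F$, and suppose that (i) $\sup_{e} \mathbb{P}(t(e) < \epsilon) \to 0$ as $\epsilon \downarrow 0$; (ii) $\sup_{e} \mathbb{E}\, t(e)^2 < \infty$. For $n \ge 1$ let $T_n = \inf_{\pi} \sum_{e \in \pi} t(e)$, where the infimum is over all finite self-avoiding paths $\pi$ in $\mathbb{Z}^d$ with endvertices the origin and $(n,0,\ldots,0)$. Then there is a constant $\mu_F > 0$, depending only on $d$ and $F$, such that $$\frac{T_n}{n} \longrightarrow \mu_F \quad \text{almost surely and in } L^2 \text{ as } n \to \infty .$$ In particular, $T_n \in L^2$ for every $n$. -/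

import Mathlib

open MeasureTheory ProbabilityTheory Filter
open scoped Topology ENNReal

namespace FirstPassage

/-- The lattice `ℤ^d`: two vertices are adjacent when their `ℓ¹` distance is `1`. -/
def lattice (d : ℕ) : SimpleGraph (Fin d → ℤ) where
  Adj x y := ∑ i, |x i - y i| = 1
  symm := ⟨fun x y h => by simpa only [abs_sub_comm] using h⟩
  loopless := ⟨fun x h => by simp at h⟩

/-- The set of edges of `ℤ^d`. -/
abbrev Edge (d : ℕ) : Type := (lattice d).edgeSet

/-- The vertex `(n, 0, …, 0)` of `ℤ^d`. -/
def axisPoint (d : ℕ) (n : ℕ) : Fin d → ℤ := fun i => if i.val = 0 then (n : ℤ) else 0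

/-- The passage time `∑ τ(e)` of a walk, the sum being over its edges. -/
noncomputable def passageTime {d : ℕ} (τ : Edge d → ℝ) {x y : Fin d → ℤ}
    (p : (lattice d).Walk x y) : ℝ :=
  (p.edges.attach.map fun e => τ ⟨e.1, p.edges_subset_edgeSet e.2⟩).sum

/-- The minimum passage time `T_n` between the origin and `(n, 0, …, 0)`: the infimum of the passage
times of the finite self-avoiding paths between these two vertices. -/
noncomputable def minPassageTime {d : ℕ} (τ : Edge d → ℝ) (n : ℕ) : ℝ :=
  ⨅ p : (lattice d).Path 0 (axisPoint d n), passageTime τ p.1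

/-- `sup_e P(t(e) < ε) → 0` as `ε ↓ 0`. -/
def SmallTimesUnlikely {d : ℕ} {Ω : Type*} [MeasurableSpace Ω] (P : Measure Ω)
    (t : Edge d → Ω → ℝ) : Prop :=
  Tendsto (fun ε : ℝ => ⨆ e, P {ω | t e ω < ε}) (𝓝[>] 0) (𝓝 0)

/-- `sup_e E t(e)² < ∞`. -/
def BoundedSecondMoment {d : ℕ} {Ω : Type*} [MeasurableSpace Ω] (P : Measure Ω)
    (t : Edge d → Ω → ℝ) : Prop :=
  ⨆ e, ∫⁻ ω, ENNReal.ofReal (t e ω ^ 2) ∂P < ∞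

end FirstPassage

/-! Concatenating paths and translating the lattice make `E T_n` subadditive, so `E T_n / n`
converges to some `μ` by Fekete's lemma. The rest is concentration: `Var T_n = O(n)`.

By the Efron–Stein inequality (`variance_le_sum_integral_sq_posPart`), the variance is at most the
sum over edges of the mean squared increase of `T_n` when that edge is resampled. Resampling raises
the minimum only if the edge lies on the minimising path, and then by at most the new time. Hence
the variance is at most `E t²` times the mean length of the minimiser (`variance_finMin_le`, then a
limit from finite families of paths).

That length is controlled by `exists_length_le_walkTime`: there are at most `(2d)^k` paths of length
`k` from the origin, and since `t > 0` almost surely, the Laplace transform of a path's time beats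
this count at a large parameter. So length is at most `r * time + W` for all paths at once, with `E
W < ∞`. As a path to `(n, 0, …, 0)` has at least `n` edges, the same bound yields `μ > 0`.

A variance of order `n` gives `L²` convergence directly, and almost sure convergence along the
squares. Between squares, `T_n` moves by at most the passage time of a segment of the axis. -/

namespace FirstPassage

/-! ### Efron–Stein inequality -/

section EfronStein

variable {ι S : Type*} [MeasurableSpace S]

/-- Exchange the coordinates in `A` of two configurations. -/
noncomputable def swapOn [DecidableEq ι] (A : Finset ι) (z : (ι → S) × (ι → S)) :
    (ι → S) × (ι → S) :=
  (A.piecewise z.2 z.1, A.piecewise z.1 z.2)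

/-- Two independent configurations form one i.i.d. family indexed by `Bool × ι`, and the exchange is
an injective relabelling of its indices. -/
theorem measurePreserving_swapOn [DecidableEq ι] (G : Measure S) [IsProbabilityMeasure G]
    (A : Finset ι) :
    MeasurePreserving (swapOn A)
      ((Measure.infinitePi fun _ : ι => G).prod (Measure.infinitePi fun _ : ι => G))
      ((Measure.infinitePi fun _ : ι => G).prod (Measure.infinitePi fun _ : ι => G)) := by
  set ρ : Measure (Bool × ι → S) := Measure.infinitePi fun _ => G
  let φ : (Bool × ι → S) → (ι → S) × (ι → S) :=
    fun w => (fun i => w (true, i), fun i => w (false, i))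
  have hφm : Measurable φ := by fun_prop
  have hφ : ρ.map φ =
      (Measure.infinitePi fun _ : ι => G).prod (Measure.infinitePi fun _ : ι => G) := by
    have h1 := Measure.infinitePi_map_curry (ι := Bool) (κ := ι) (fun _ _ => G)
    have h2 := Measure.infinitePi_map_eval_prod
      (P := fun _ : Bool => Measure.infinitePi fun _ : ι => G) (i := true) (j := false) (by simp)
    rw [← h2, ← h1, Measure.map_map (by fun_prop) (by fun_prop)]
    rfl
  let g : Bool × ι → Bool × ι := fun p => if p.2 ∈ A then (!p.1, p.2) else p
  have hg : Function.Injective g := by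
    intro p q hpq
    obtain ⟨a, i⟩ := p
    obtain ⟨b, j⟩ := q
    simp only [g] at hpq
    split_ifs at hpq <;> simp_all
  have hρ : ρ.map (fun w p => w (g p)) = ρ := Measure.map_infinitePi_infinitePi_of_inj hg
  have hm : Measurable (swapOn (S := S) A) := by
    unfold swapOn
    refine Measurable.prodMk ?_ ?_ <;>
    · refine measurable_pi_lambda _ fun i => ?_
      by_cases hi : i ∈ A <;> simp only [Finset.piecewise, hi, if_true, if_false] <;> fun_prop
  refine ⟨hm, ?_⟩
  rw [← hφ, Measure.map_map hm hφm]
  conv_rhs => rw [← hρ]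
  rw [Measure.map_map hφm (by fun_prop)]
  congr 1
  funext w
  refine Prod.ext ?_ ?_ <;>
  · funext i
    by_cases hi : i ∈ A <;> simp [swapOn, φ, g, hi, Finset.piecewise]

variable [DecidableEq ι] {G : Measure S} [IsProbabilityMeasure G]

theorem memLp_piecewise {f : (ι → S) → ℝ} (hf : MemLp f 2 (Measure.infinitePi fun _ => G))
    (A : Finset ι) :
    MemLp (fun z : (ι → S) × (ι → S) => f (A.piecewise z.2 z.1)) 2
      ((Measure.infinitePi fun _ : ι => G).prod (Measure.infinitePi fun _ : ι => G)) :=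
  (hf.comp_measurePreserving measurePreserving_fst).comp_measurePreserving
    (measurePreserving_swapOn G A)

/-- Telescope over the resampled set. Exchanging coordinate `e` symmetrises each increment, so that
twice it is the mean of a product of two differences. By `2uv ≤ u² + v²` this is at most half the
sum of their mean squares, and exchanging the coordinates in `A` shows that the two mean squares
agree. -/
theorem integral_mul_sub_piecewise_le {f : (ι → S) → ℝ}
    (hf : MemLp f 2 (Measure.infinitePi fun _ => G)) (A : Finset ι) :
    ∫ z : (ι → S) × (ι → S), f z.1 * (f z.1 - f (A.piecewise z.2 z.1))
      ∂((Measure.infinitePi fun _ : ι => G).prod (Measure.infinitePi fun _ : ι => G)) ≤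
    ∑ e ∈ A, 2⁻¹ * ∫ z : (ι → S) × (ι → S),
      (f z.1 - f (({e} : Finset ι).piecewise z.2 z.1)) ^ 2
      ∂((Measure.infinitePi fun _ : ι => G).prod (Measure.infinitePi fun _ : ι => G)) := by
  set Q := (Measure.infinitePi fun _ : ι => G).prod (Measure.infinitePi fun _ : ι => G)
  have h1 : MemLp (fun z : (ι → S) × (ι → S) => f z.1) 2 Q :=
    hf.comp_measurePreserving measurePreserving_fst
  have hA : ∀ A : Finset ι, MemLp (fun z : (ι → S) × (ι → S) => f (A.piecewise z.2 z.1)) 2 Q :=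
    fun A => memLp_piecewise hf A
  have hpres : ∀ (A : Finset ι) (g : (ι → S) × (ι → S) → ℝ), AEStronglyMeasurable g Q →
      ∫ z, g (swapOn A z) ∂Q = ∫ z, g z ∂Q := by
    intro A g hg
    have hm := measurePreserving_swapOn G A
    rw [← integral_map hm.measurable.aemeasurable (by rw [hm.map_eq]; exact hg), hm.map_eq]
  induction A using Finset.induction_on with
  | empty => simp
  | insert e A he ih =>
    rw [Finset.sum_insert he]
    have e2 : ∀ z : (ι → S) × (ι → S), A.piecewise (swapOn {e} z).2 (swapOn {e} z).1 =
        (insert e A).piecewise z.2 z.1 := by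
      intro z; funext i
      by_cases hi : i = e
      · subst hi; simp [swapOn, Finset.piecewise, he]
      · by_cases hiA : i ∈ A <;> simp [swapOn, Finset.piecewise, hi, hiA]
    have e3 : ∀ z : (ι → S) × (ι → S), (insert e A).piecewise (swapOn {e} z).2 (swapOn {e} z).1 =
        A.piecewise z.2 z.1 := by
      intro z; funext i
      by_cases hi : i = e
      · subst hi; simp [swapOn, Finset.piecewise, he]
      · by_cases hiA : i ∈ A <;> simp [swapOn, Finset.piecewise, hi, hiA]
    have e4 : ∀ z : (ι → S) × (ι → S), ({e} : Finset ι).piecewise (swapOn A z).2 (swapOn A z).1 =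
        (insert e A).piecewise z.2 z.1 := by
      intro z; funext i
      by_cases hi : i = e
      · subst hi; simp [swapOn, Finset.piecewise, he]
      · by_cases hiA : i ∈ A <;> simp [swapOn, Finset.piecewise, hi, hiA]
    have i1 : Integrable (fun z : (ι → S) × (ι → S) =>
        f z.1 * (f z.1 - f (A.piecewise z.2 z.1))) Q := h1.integrable_mul (h1.sub (hA A))
    have i2 : Integrable (fun z : (ι → S) × (ι → S) =>
        f z.1 * (f (A.piecewise z.2 z.1) - f ((insert e A).piecewise z.2 z.1))) Q :=
      h1.integrable_mul ((hA A).sub (hA _))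
    have i3 : Integrable (fun z : (ι → S) × (ι → S) => f (({e} : Finset ι).piecewise z.2 z.1) *
        (f ((insert e A).piecewise z.2 z.1) - f (A.piecewise z.2 z.1))) Q :=
      (hA {e}).integrable_mul ((hA _).sub (hA A))
    have i4 : Integrable (fun z : (ι → S) × (ι → S) =>
        (f z.1 - f (({e} : Finset ι).piecewise z.2 z.1)) ^ 2) Q := (h1.sub (hA {e})).integrable_sq
    have i5 : Integrable (fun z : (ι → S) × (ι → S) =>
        (f (A.piecewise z.2 z.1) - f ((insert e A).piecewise z.2 z.1)) ^ 2) Q :=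
      ((hA A).sub (hA _)).integrable_sq
    have hs1 : ∫ z, f (({e} : Finset ι).piecewise z.2 z.1) *
        (f ((insert e A).piecewise z.2 z.1) - f (A.piecewise z.2 z.1)) ∂Q =
        ∫ z, f z.1 * (f (A.piecewise z.2 z.1) - f ((insert e A).piecewise z.2 z.1)) ∂Q := by
      rw [← hpres {e} _ i2.aestronglyMeasurable]
      simp only [e2, e3]
      rfl
    have hs2 : ∫ z, (f (A.piecewise z.2 z.1) - f ((insert e A).piecewise z.2 z.1)) ^ 2 ∂Q =
        ∫ z, (f z.1 - f (({e} : Finset ι).piecewise z.2 z.1)) ^ 2 ∂Q := by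
      rw [← hpres A _ i4.aestronglyMeasurable]
      simp only [e4]
      rfl
    have hsplit : ∫ z, f z.1 * (f z.1 - f ((insert e A).piecewise z.2 z.1)) ∂Q =
        ∫ z, f z.1 * (f z.1 - f (A.piecewise z.2 z.1)) ∂Q +
        ∫ z, f z.1 * (f (A.piecewise z.2 z.1) - f ((insert e A).piecewise z.2 z.1)) ∂Q := by
      rw [← integral_add i1 i2]
      congr 1; funext z; ring
    have hle : ∫ z, f z.1 * (f (A.piecewise z.2 z.1) - f ((insert e A).piecewise z.2 z.1)) ∂Q +
        ∫ z, f (({e} : Finset ι).piecewise z.2 z.1) *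
        (f ((insert e A).piecewise z.2 z.1) - f (A.piecewise z.2 z.1)) ∂Q ≤
        2⁻¹ * ∫ z, (f z.1 - f (({e} : Finset ι).piecewise z.2 z.1)) ^ 2 ∂Q +
        2⁻¹ * ∫ z, (f (A.piecewise z.2 z.1) - f ((insert e A).piecewise z.2 z.1)) ^ 2 ∂Q := by
      rw [← integral_add i2 i3, ← integral_const_mul, ← integral_const_mul,
        ← integral_add (i4.const_mul _) (i5.const_mul _)]
      refine integral_mono (i2.add i3) ((i4.const_mul _).add (i5.const_mul _)) fun z => ?_
      have := sq_nonneg ((f z.1 - f (({e} : Finset ι).piecewise z.2 z.1)) -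
        (f (A.piecewise z.2 z.1) - f ((insert e A).piecewise z.2 z.1)))
      simp only
      nlinarith
    rw [hsplit]
    linarith

/-- **Efron–Stein inequality** for a function of finitely many coordinates of an i.i.d. family,
in its one-sided form. -/
theorem variance_le_sum_integral_sq_posPart {f : (ι → S) → ℝ}
    (hf : MemLp f 2 (Measure.infinitePi fun _ => G)) (A : Finset ι)
    (hfA : ∀ x y : ι → S, (∀ i ∈ A, x i = y i) → f x = f y) :
    Var[f; Measure.infinitePi fun _ => G] ≤
    ∑ e ∈ A, ∫ z : (ι → S) × (ι → S), max (f (Function.update z.1 e (z.2 e)) - f z.1) 0 ^ 2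
      ∂((Measure.infinitePi fun _ : ι => G).prod (Measure.infinitePi fun _ : ι => G)) := by
  have key := integral_mul_sub_piecewise_le hf A
  set Q := (Measure.infinitePi fun _ : ι => G).prod (Measure.infinitePi fun _ : ι => G)
  have h1 : MemLp (fun z : (ι → S) × (ι → S) => f z.1) 2 Q :=
    hf.comp_measurePreserving measurePreserving_fst
  have h2 : MemLp (fun z : (ι → S) × (ι → S) => f z.2) 2 Q :=
    hf.comp_measurePreserving measurePreserving_snd
  -- As `f` sees only the coordinates in `A`, resampling all of them gives an independent copy of
  -- `f`.
  have hvar : Var[f; Measure.infinitePi fun _ => G] =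
      ∫ z : (ι → S) × (ι → S), f z.1 * (f z.1 - f (A.piecewise z.2 z.1)) ∂Q := by
    have : ∀ z : (ι → S) × (ι → S), f z.1 * (f z.1 - f (A.piecewise z.2 z.1)) =
        f z.1 ^ 2 - f z.1 * f z.2 := by
      intro z
      rw [hfA (A.piecewise z.2 z.1) z.2 fun i hi => by simp [Finset.piecewise, hi]]
      ring
    simp only [this]
    have hmul : Integrable (fun z : (ι → S) × (ι → S) => f z.1 * f z.2) Q := h1.integrable_mul h2
    rw [integral_sub h1.integrable_sq hmul, integral_prod_mul,
      variance_eq_sub hf]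
    have := integral_fun_fst (μ := Measure.infinitePi fun _ : ι => G)
      (ν := Measure.infinitePi fun _ : ι => G) (f := fun x => f x ^ 2)
    simp only [probReal_univ, one_smul] at this
    rw [this]
    simp [pow_two]
  rw [hvar]
  refine key.trans (Finset.sum_le_sum fun e _ => ?_)
  have hup : ∀ z : (ι → S) × (ι → S), ({e} : Finset ι).piecewise z.2 z.1 =
      Function.update z.1 e (z.2 e) := fun z => Finset.piecewise_singleton _ _ _
  have h3 : MemLp (fun z : (ι → S) × (ι → S) => f (Function.update z.1 e (z.2 e))) 2 Q := by
    simpa only [hup] using memLp_piecewise hf {e}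
  have hpos : ∀ {u v : (ι → S) × (ι → S) → ℝ}, MemLp u 2 Q → MemLp v 2 Q →
      Integrable (fun z => max (u z - v z) 0 ^ 2) Q := fun hu hv =>
    ((hu.sub hv).pos_part).integrable_sq
  -- By symmetry the positive and negative parts have equal mean squares; this absorbs the factor
  -- `2⁻¹`.
  have hswap : ∫ z : (ι → S) × (ι → S), max (f z.1 - f (Function.update z.1 e (z.2 e))) 0 ^ 2 ∂Q =
      ∫ z : (ι → S) × (ι → S), max (f (Function.update z.1 e (z.2 e)) - f z.1) 0 ^ 2 ∂Q := by
    have hm : MeasurePreserving (swapOn {e}) Q Q := measurePreserving_swapOn G {e}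
    conv_rhs => rw [← hm.map_eq]
    rw [integral_map hm.measurable.aemeasurable
      (by rw [hm.map_eq]; exact (hpos h3 h1).aestronglyMeasurable)]
    congr 1; funext z
    have a1 : (swapOn {e} z).1 = Function.update z.1 e (z.2 e) := hup z
    have a2 : Function.update (swapOn {e} z).1 e ((swapOn {e} z).2 e) = z.1 := by
      rw [a1]; simp [swapOn, Finset.piecewise]
    rw [a1] at a2 ⊢
    rw [a2]
  have : ∫ z : (ι → S) × (ι → S), (f z.1 - f (({e} : Finset ι).piecewise z.2 z.1)) ^ 2 ∂Q =
      ∫ z : (ι → S) × (ι → S), max (f z.1 - f (Function.update z.1 e (z.2 e))) 0 ^ 2 ∂Q +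
      ∫ z : (ι → S) × (ι → S), max (f (Function.update z.1 e (z.2 e)) - f z.1) 0 ^ 2 ∂Q := by
    rw [← integral_add (hpos h1 h3) (hpos h3 h1)]
    congr 1; funext z
    rw [hup]
    rcases le_total (f z.1) (f (Function.update z.1 e (z.2 e))) with h | h
    · rw [max_eq_right (sub_nonpos.2 h), max_eq_left (sub_nonneg.2 h)]; ring
    · rw [max_eq_left (sub_nonneg.2 h), max_eq_right (sub_nonpos.2 h)]; ring
  rw [this, hswap]
  linarith

end EfronStein

/-! ### Passage times of paths, and counting paths -/

section Deterministic

variable {d : ℕ} {x y z : Fin d → ℤ} {τ : Edge d → ℝ}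

/-- Countability makes the infimum over paths measurable and a limit of finite minima. -/
instance countable_path : Countable ((lattice d).Path x y) :=
  Function.Injective.countable (f := fun p : (lattice d).Path x y => p.1.support)
    fun _ _ h => Subtype.ext (SimpleGraph.Walk.ext_support h)

instance countable_edge : Countable (Edge d) := by
  have : Countable (Sym2 (Fin d → ℤ)) := inferInstanceAs (Countable (Quot _))
  exact Subtype.countable

open Classical in
/-- Extension by zero of a function on the edges to all unordered pairs. -/
noncomputable def extendByZero (τ : Edge d → ℝ) (e : Sym2 (Fin d → ℤ)) : ℝ :=
  if h : e ∈ (lattice d).edgeSet then τ ⟨e, h⟩ else 0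

theorem extendByZero_nonneg (hτ : ∀ e, 0 ≤ τ e) (e : Sym2 (Fin d → ℤ)) :
    0 ≤ extendByZero τ e := by
  unfold extendByZero
  split_ifs
  · exact hτ _
  · exact le_rfl

theorem passageTime_eq_sum_extendByZero (τ : Edge d → ℝ) (p : (lattice d).Walk x y) :
    passageTime τ p = (p.edges.map (extendByZero τ)).sum := by
  unfold passageTime
  conv_rhs => rw [← List.attach_map_subtype_val p.edges, List.map_map]
  congr 1
  refine List.map_congr_left fun e _ => ?_
  simp [extendByZero, p.edges_subset_edgeSet e.2]

theorem passageTime_append (τ : Edge d → ℝ) (p : (lattice d).Walk x y) (q : (lattice d).Walk y z) :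
    passageTime τ (p.append q) = passageTime τ p + passageTime τ q := by
  simp [passageTime_eq_sum_extendByZero, SimpleGraph.Walk.edges_append]

theorem passageTime_reverse (τ : Edge d → ℝ) (p : (lattice d).Walk x y) :
    passageTime τ p.reverse = passageTime τ p := by
  simp [passageTime_eq_sum_extendByZero, SimpleGraph.Walk.edges_reverse]

theorem passageTime_nil (τ : Edge d → ℝ) :
    passageTime τ (SimpleGraph.Walk.nil : (lattice d).Walk x x) = 0 := by
  simp [passageTime_eq_sum_extendByZero]

theorem passageTime_cons (τ : Edge d → ℝ) (h : (lattice d).Adj x y) (p : (lattice d).Walk y z) :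
    passageTime τ (p.cons h) = τ ⟨s(x, y), h⟩ + passageTime τ p := by
  simp [passageTime_eq_sum_extendByZero, extendByZero, h]

theorem passageTime_nonneg (hτ : ∀ e, 0 ≤ τ e) (p : (lattice d).Walk x y) :
    0 ≤ passageTime τ p :=
  List.sum_nonneg (by simp only [List.mem_map]; rintro _ ⟨e, -, rfl⟩; exact hτ _)

theorem passageTime_bypass_le (hτ : ∀ e, 0 ≤ τ e) (p : (lattice d).Walk x y) :
    passageTime τ p.bypass ≤ passageTime τ p := by
  simp only [passageTime_eq_sum_extendByZero]
  refine (p.edges_bypass_sublist_edges.map _).sum_le_sum fun a ha => ?_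
  obtain ⟨e, -, rfl⟩ := List.mem_map.1 ha
  exact extendByZero_nonneg hτ e

theorem passageTime_map (τ : Edge d → ℝ) (f : lattice d →g lattice d) (p : (lattice d).Walk x y) :
    passageTime τ (p.map f) = passageTime (fun e => τ (f.mapEdgeSet e)) p := by
  induction p with
  | nil => simp [passageTime_nil]
  | cons h p ih => rw [SimpleGraph.Walk.map_cons, passageTime_cons, passageTime_cons, ih]; rfl

/-- The set of edges of a path. -/
noncomputable def pathEdges (p : (lattice d).Path x y) : Finset (Edge d) :=
  open Classical in
  (p.1.edges.attach.map fun e => (⟨e.1, p.1.edges_subset_edgeSet e.2⟩ : Edge d)).toFinset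

theorem nodup_edgeList (p : (lattice d).Path x y) :
    (p.1.edges.attach.map fun e =>
      (⟨e.1, p.1.edges_subset_edgeSet e.2⟩ : Edge d)).Nodup := by
  refine (List.nodup_attach.2 p.2.isTrail.edges_nodup).map fun a b h => ?_
  exact Subtype.ext (Subtype.mk.inj h)

theorem card_pathEdges (p : (lattice d).Path x y) : (pathEdges p).card = p.1.length := by
  unfold pathEdges
  rw [List.toFinset_card_of_nodup (nodup_edgeList p)]
  simp

theorem passageTime_eq_sum_pathEdges (τ : Edge d → ℝ) (p : (lattice d).Path x y) :
    passageTime τ p.1 = ∑ e ∈ pathEdges p, τ e := by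
  unfold pathEdges
  rw [List.sum_toFinset _ (nodup_edgeList p), List.map_map]
  rfl

/-- The minimum passage time between two vertices. -/
noncomputable def passageDist (τ : Edge d → ℝ) (x y : Fin d → ℤ) : ℝ :=
  ⨅ p : (lattice d).Path x y, passageTime τ p.1

theorem bddBelow_passageTime (hτ : ∀ e, 0 ≤ τ e) :
    BddBelow (Set.range fun p : (lattice d).Path x y => passageTime τ p.1) :=
  ⟨0, by rintro _ ⟨p, rfl⟩; exact passageTime_nonneg hτ _⟩

theorem passageDist_nonneg (hτ : ∀ e, 0 ≤ τ e) : 0 ≤ passageDist τ x y :=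
  Real.iInf_nonneg fun _ => passageTime_nonneg hτ _

theorem passageDist_le (hτ : ∀ e, 0 ≤ τ e) (p : (lattice d).Walk x y) :
    passageDist τ x y ≤ passageTime τ p :=
  (ciInf_le (bddBelow_passageTime hτ) p.toPath).trans (passageTime_bypass_le hτ p)

theorem passageDist_triangle (hτ : ∀ e, 0 ≤ τ e) (hxy : Nonempty ((lattice d).Path x y))
    (hyz : Nonempty ((lattice d).Path y z)) :
    passageDist τ x z ≤ passageDist τ x y + passageDist τ y z := by
  refine le_ciInf_add_ciInf fun p q => ?_
  rw [← passageTime_append]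
  exact passageDist_le hτ _

theorem passageDist_comm_le (hτ : ∀ e, 0 ≤ τ e) (h : Nonempty ((lattice d).Path y x)) :
    passageDist τ x y ≤ passageDist τ y x :=
  le_ciInf fun p => by
    rw [← passageTime_reverse]
    exact passageDist_le hτ _

theorem adj_axisPoint (hd : 0 < d) (n : ℕ) :
    (lattice d).Adj (axisPoint d n) (axisPoint d (n + 1)) := by
  change ∑ i, |axisPoint d n i - axisPoint d (n + 1) i| = 1
  rw [Finset.sum_eq_single ⟨0, hd⟩]
  · simp [axisPoint]
  · intro i _ hi
    have : i.val ≠ 0 := fun h => hi (Fin.ext h)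
    simp [axisPoint, this]
  · simp

/-- The edge joining `(n, 0, …, 0)` to `(n + 1, 0, …, 0)`. -/
def axisEdge (hd : 0 < d) (n : ℕ) : Edge d :=
  ⟨s(axisPoint d n, axisPoint d (n + 1)), adj_axisPoint hd n⟩

theorem exists_axis_walk (hd : 0 < d) {m n : ℕ} (hmn : m ≤ n) :
    ∃ p : (lattice d).Walk (axisPoint d m) (axisPoint d n),
      ∀ τ, passageTime τ p = ∑ j ∈ Finset.Ico m n, τ (axisEdge hd j) := by
  induction n, hmn using Nat.le_induction with
  | base => exact ⟨.nil, fun τ => by simp [passageTime_nil]⟩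
  | succ n hn ih =>
    obtain ⟨p, hp⟩ := ih
    refine ⟨p.append (.cons (adj_axisPoint hd n) .nil), fun τ => ?_⟩
    rw [passageTime_append, hp, passageTime_cons, passageTime_nil, Finset.sum_Ico_succ_top hn,
      add_zero]
    rfl

theorem nonempty_path_axisPoint (hd : 0 < d) {m n : ℕ} (hmn : m ≤ n) :
    Nonempty ((lattice d).Path (axisPoint d m) (axisPoint d n)) :=
  let ⟨p, _⟩ := exists_axis_walk hd hmn
  ⟨p.toPath⟩

theorem axisPoint_zero : axisPoint d 0 = 0 := by
  funext i
  simp [axisPoint]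

theorem nonempty_path_zero_axisPoint (hd : 0 < d) (n : ℕ) :
    Nonempty ((lattice d).Path 0 (axisPoint d n)) :=
  axisPoint_zero (d := d) ▸ nonempty_path_axisPoint hd (Nat.zero_le n)

theorem minPassageTime_nonneg (hτ : ∀ e, 0 ≤ τ e) (n : ℕ) : 0 ≤ minPassageTime τ n :=
  passageDist_nonneg hτ

theorem passageDist_axisPoint_le (hd : 0 < d) (hτ : ∀ e, 0 ≤ τ e) {m n : ℕ} (hmn : m ≤ n) :
    passageDist τ (axisPoint d m) (axisPoint d n) ≤ ∑ j ∈ Finset.Ico m n, τ (axisEdge hd j) := by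
  obtain ⟨p, hp⟩ := exists_axis_walk hd hmn
  rw [← hp]
  exact passageDist_le hτ p

/-- The triangle inequality, with the axis segment traversed in either direction. -/
theorem abs_minPassageTime_sub_le (hd : 0 < d) (hτ : ∀ e, 0 ≤ τ e) {m n : ℕ} (hmn : m ≤ n) :
    |minPassageTime τ n - minPassageTime τ m| ≤ ∑ j ∈ Finset.Ico m n, τ (axisEdge hd j) := by
  have hne := nonempty_path_axisPoint hd hmn
  have hne' : Nonempty ((lattice d).Path (axisPoint d n) (axisPoint d m)) :=
    ⟨hne.some.reverse⟩
  have h := passageDist_axisPoint_le hd hτ hmn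
  have h1 := passageDist_triangle hτ (nonempty_path_zero_axisPoint hd m) hne
  have h2 := passageDist_triangle hτ (nonempty_path_zero_axisPoint hd n) hne'
  have h3 := passageDist_comm_le hτ hne
  change |passageDist τ 0 _ - passageDist τ 0 _| ≤ _
  rw [abs_le]
  constructor <;> linarith

theorem minPassageTime_le (hd : 0 < d) (hτ : ∀ e, 0 ≤ τ e) (n : ℕ) :
    minPassageTime τ n ≤ ∑ j ∈ Finset.range n, τ (axisEdge hd j) := by
  have := passageDist_axisPoint_le hd hτ (Nat.zero_le n)
  rwa [axisPoint_zero, ← Finset.range_eq_Ico] at this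

theorem abs_sub_le_length (p : (lattice d).Walk x y) (i : Fin d) : |x i - y i| ≤ p.length := by
  induction p with
  | nil => simp
  | @cons u v w h p ih =>
    have h1 : |u i - v i| ≤ 1 := by
      rw [← show ∑ i, |u i - v i| = 1 from h]
      exact Finset.single_le_sum (f := fun i => |u i - v i|) (fun _ _ => abs_nonneg _)
        (Finset.mem_univ i)
    have h2 := abs_sub_le (u i) (v i) (w i)
    rw [SimpleGraph.Walk.length_cons]
    push_cast
    linarith

theorem le_length_of_walk_axisPoint (hd : 0 < d) {n : ℕ}
    (p : (lattice d).Walk 0 (axisPoint d n)) : n ≤ p.length := by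
  have := abs_sub_le_length p ⟨0, hd⟩
  simpa [axisPoint] using this

/-- Translation by `v`, as an endomorphism of the lattice. -/
def translate (v : Fin d → ℤ) : lattice d →g lattice d where
  toFun x := x + v
  map_rel' {a b} h := by
    have h : ∑ i, |a i - b i| = 1 := h
    change ∑ i, |(a + v) i - (b + v) i| = 1
    simpa using h

/-- A path to `(m, 0, …, 0)` can be followed by the translate of a path to `(n, 0, …, 0)`. -/
theorem minPassageTime_add_le (hd : 0 < d) (hτ : ∀ e, 0 ≤ τ e) (m n : ℕ) :
    minPassageTime τ (m + n) ≤ minPassageTime τ m +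
      minPassageTime (fun e => τ ((translate (axisPoint d m)).mapEdgeSet e)) n := by
  have hne := nonempty_path_axisPoint hd (Nat.le_add_right m n)
  refine (passageDist_triangle hτ (nonempty_path_zero_axisPoint hd m) hne).trans ?_
  refine add_le_add_right (?_ : _ ≤ passageDist _ _ _) _
  have := nonempty_path_zero_axisPoint hd n
  refine le_ciInf fun p => ?_
  rw [← passageTime_map]
  have e1 : translate (axisPoint d m) 0 = axisPoint d m := zero_add _
  have e2 : translate (axisPoint d m) (axisPoint d n) = axisPoint d (m + n) := by
    funext i
    change axisPoint d n i + axisPoint d m i = _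
    by_cases hi : i.val = 0 <;> simp [axisPoint, hi, add_comm]
  have := passageDist_le hτ (p.1.map (translate (axisPoint d m)))
  calc passageDist τ (axisPoint d m) (axisPoint d (m + n))
      = passageDist τ (translate (axisPoint d m) 0)
          (translate (axisPoint d m) (axisPoint d n)) := by rw [e1, e2]
    _ ≤ _ := this

theorem exists_eq_add_single_of_adj (h : (lattice d).Adj x y) :
    ∃ s : Fin d × Bool, y = x + Pi.single s.1 (if s.2 then 1 else -1) := by
  have h : ∑ i, |x i - y i| = 1 := h
  obtain ⟨i, hi⟩ : ∃ i, 1 ≤ |x i - y i| := by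
    by_contra! hcon
    have : ∑ i, |x i - y i| ≤ ∑ _i : Fin d, (0 : ℤ) :=
      Finset.sum_le_sum fun i _ => Int.lt_add_one_iff.1 (hcon i)
    simp [h] at this
  have hsum := Finset.add_sum_erase Finset.univ (fun i => |x i - y i|) (Finset.mem_univ i)
  have hnn : 0 ≤ ∑ j ∈ Finset.univ.erase i, |x j - y j| :=
    Finset.sum_nonneg fun _ _ => abs_nonneg _
  have hz : ∑ j ∈ Finset.univ.erase i, |x j - y j| = 0 := by omega
  have hi1 : |x i - y i| = 1 := by omega
  have hj : ∀ j, j ≠ i → x j = y j := fun j hji => by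
    have := (Finset.sum_eq_zero_iff_of_nonneg fun _ _ => abs_nonneg _).1 hz j (by simp [hji])
    simpa [sub_eq_zero] using this
  rcases (abs_eq zero_le_one).1 hi1 with h1 | h1
  · refine ⟨(i, false), funext fun j => ?_⟩
    by_cases hji : j = i
    · subst hji; simp; omega
    · simp [hji, hj j hji]
  · refine ⟨(i, true), funext fun j => ?_⟩
    by_cases hji : j = i
    · subst hji; simp; omega
    · simp [hji, hj j hji]

/-- The list of directions of the steps of a walk. -/
noncomputable def directions {x y : Fin d → ℤ} : (lattice d).Walk x y → List (Fin d × Bool)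
  | .nil => []
  | .cons h p => (exists_eq_add_single_of_adj h).choose :: directions p

theorem length_directions (p : (lattice d).Walk x y) : (directions p).length = p.length := by
  induction p with
  | nil => rfl
  | cons h p ih => simp [directions, ih]

/-- The starting point and the directions determine a walk, its end included, so walks from a given
vertex can be counted as words in `2d` letters. -/
theorem directions_injective (p : (lattice d).Walk x y) (q : (lattice d).Walk x z)
    (h : directions p = directions q) :
    (⟨y, p⟩ : Σ y, (lattice d).Walk x y) = ⟨z, q⟩ := by
  induction p with
  | nil =>
    cases q with
    | nil => rfl
    | cons h' q => simp [directions] at h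
  | @cons u v w hu p ih =>
    cases q with
    | nil => simp [directions] at h
    | @cons _ v' _ hu' q =>
      simp only [directions, List.cons.injEq] at h
      have hv : v = v' := by
        rw [(exists_eq_add_single_of_adj hu).choose_spec,
          (exists_eq_add_single_of_adj hu').choose_spec, h.1]
      subst hv
      have := ih q h.2
      rw [Sigma.mk.injEq] at this
      obtain ⟨rfl, h2⟩ := this
      rw [eq_of_heq h2]

theorem tsum_path_le (x : Fin d → ℤ) (g : ℕ → ℝ≥0∞) :
    ∑' q : (Σ y, (lattice d).Path x y), g q.2.1.length ≤ ∑' k : ℕ, (2 * d : ℕ) ^ k * g k := by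
  have hinj : Function.Injective fun q : (Σ y, (lattice d).Path x y) => directions q.2.1 := by
    rintro ⟨y, p⟩ ⟨z, q⟩ h
    have := directions_injective p.1 q.1 h
    rw [Sigma.mk.injEq] at this
    obtain ⟨rfl, h2⟩ := this
    rw [Subtype.ext (eq_of_heq h2)]
  calc ∑' q : (Σ y, (lattice d).Path x y), g q.2.1.length
      = ∑' q : (Σ y, (lattice d).Path x y), g (directions q.2.1).length := by
        simp only [length_directions]
    _ ≤ ∑' l : List (Fin d × Bool), g l.length :=
        ENNReal.tsum_comp_le_tsum_of_injective hinj fun l => g l.length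
    _ = ∑' s : (Σ n, Fin n → Fin d × Bool), g s.1 := by
        rw [← List.equivSigmaTuple.tsum_eq]
        rfl
    _ = ∑' k : ℕ, (2 * d : ℕ) ^ k * g k := by
        rw [ENNReal.tsum_sigma']
        refine tsum_congr fun k => ?_
        rw [tsum_fintype]
        simp [mul_comm]

end Deterministic

/-! ### The product space: lengths of paths and variance of the minimum -/

section Canonical

open scoped NNReal

/-- The law of an i.i.d. family of passage times with common law `G`. -/
noncomputable abbrev configLaw (d : ℕ) (G : Measure ℝ≥0) : Measure (Edge d → ℝ≥0) :=
  Measure.infinitePi fun _ => G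

/-- The passage time of a walk in a configuration of nonnegative times. -/
noncomputable def walkTime {d : ℕ} {x y : Fin d → ℤ} (p : (lattice d).Walk x y)
    (τ : Edge d → ℝ≥0) : ℝ :=
  passageTime (fun e => (τ e : ℝ)) p

variable {d : ℕ} {G : Measure ℝ≥0} {x y : Fin d → ℤ}

theorem walkTime_nonneg (p : (lattice d).Walk x y) (τ : Edge d → ℝ≥0) : 0 ≤ walkTime p τ :=
  passageTime_nonneg (fun _ => NNReal.coe_nonneg _) p

theorem walkTime_path_eq_sum (p : (lattice d).Path x y) :
    walkTime p.1 = fun τ => ∑ e ∈ pathEdges p, (τ e : ℝ) :=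
  funext fun _ => passageTime_eq_sum_pathEdges _ p

theorem measurable_walkTime_path (p : (lattice d).Path x y) : Measurable (walkTime p.1) := by
  rw [walkTime_path_eq_sum]
  fun_prop

/-- Dominated convergence: the integrand vanishes in the limit except at `t = 0`, which has no mass.
-/
theorem tendsto_lintegral_exp_neg [IsProbabilityMeasure G] (hG : G {0} = 0) :
    Tendsto (fun k : ℕ => ∫⁻ t : ℝ≥0, ENNReal.ofReal (Real.exp (-(k * t))) ∂G) atTop (𝓝 0) := by
  rw [← lintegral_zero (μ := G)]
  refine tendsto_lintegral_of_dominated_convergence (fun _ => 1) (fun k => by fun_prop)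
    (fun k => ae_of_all _ fun t => ?_) (by simp) ?_
  · rw [← ENNReal.ofReal_one]
    refine ENNReal.ofReal_le_ofReal (Real.exp_le_one_iff.2 ?_)
    have : (0 : ℝ) ≤ k * t := by positivity
    linarith
  · have h0 : ∀ᵐ t ∂G, t ≠ 0 := by
      rw [ae_iff]; simpa using hG
    filter_upwards [h0] with t ht
    rw [← ENNReal.ofReal_zero]
    refine ENNReal.tendsto_ofReal (Real.tendsto_exp_atBot.comp ?_)
    refine tendsto_neg_atTop_atBot.comp ?_
    exact tendsto_natCast_atTop_atTop.atTop_mul_const (by exact_mod_cast pos_iff_ne_zero.2 ht)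

/-- The edges of a self-avoiding path are distinct, so their times are independent and the Laplace
transform factorises. -/
theorem lintegral_exp_neg_walkTime [IsProbabilityMeasure G] (p : (lattice d).Path x y) (r : ℝ) :
    ∫⁻ τ, ENNReal.ofReal (Real.exp (-(r * walkTime p.1 τ))) ∂(configLaw d G) =
      (∫⁻ t : ℝ≥0, ENNReal.ofReal (Real.exp (-(r * t))) ∂G) ^ p.1.length := by
  have hind : iIndepFun (fun (e : Edge d) (τ : Edge d → ℝ≥0) =>
      ENNReal.ofReal (Real.exp (-(r * (τ e : ℝ))))) (configLaw d G) :=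
    iIndepFun_infinitePi (P := fun _ : Edge d => G)
      (X := fun _ (t : ℝ≥0) => ENNReal.ofReal (Real.exp (-(r * (t : ℝ))))) fun _ => by fun_prop
  have heq : ∀ τ : Edge d → ℝ≥0, ENNReal.ofReal (Real.exp (-(r * walkTime p.1 τ))) =
      ∏ e ∈ pathEdges p, ENNReal.ofReal (Real.exp (-(r * (τ e : ℝ)))) := by
    intro τ
    rw [← ENNReal.ofReal_prod_of_nonneg fun _ _ => (Real.exp_pos _).le, ← Real.exp_sum,
      walkTime_path_eq_sum, Finset.mul_sum, Finset.sum_neg_distrib]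
  simp only [heq]
  rw [lintegral_prod_eq_prod_lintegral_of_indepFun _ _ hind fun e => by fun_prop,
    ← card_pathEdges, ← Finset.prod_const]
  refine Finset.prod_congr rfl fun e _ => ?_
  have h := measurePreserving_eval_infinitePi (fun _ : Edge d => G) e
  exact h.lintegral_comp (f := fun t : ℝ≥0 => ENNReal.ofReal (Real.exp (-(r * (t : ℝ)))))
    (by fun_prop)

/-- The lengths of all paths from the origin are controlled by a multiple of their passage times,
up to a random variable with finite mean. -/
theorem exists_length_le_walkTime [IsProbabilityMeasure G] (hG : G {0} = 0) :
    ∃ r : ℝ, 0 < r ∧ ∃ W : (Edge d → ℝ≥0) → ℝ≥0∞, ∫⁻ τ, W τ ∂(configLaw d G) ≠ ∞ ∧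
      ∀ (τ : Edge d → ℝ≥0) (y : Fin d → ℤ) (p : (lattice d).Path 0 y),
        (p.1.length : ℝ≥0∞) ≤ ENNReal.ofReal (r * walkTime p.1 τ) + W τ := by
  have hlim : Tendsto (fun k : ℕ => ((2 * d : ℕ) : ℝ≥0∞) * ENNReal.ofReal (Real.exp 1) *
      ∫⁻ t : ℝ≥0, ENNReal.ofReal (Real.exp (-(k * t))) ∂G) atTop (𝓝 0) := by
    have := ENNReal.Tendsto.const_mul (a := ((2 * d : ℕ) : ℝ≥0∞) * ENNReal.ofReal (Real.exp 1))
      (tendsto_lintegral_exp_neg hG)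
      (Or.inr (ENNReal.mul_ne_top (ENNReal.natCast_ne_top _) ENNReal.ofReal_ne_top))
    simpa using this
  -- With `2d * e * φ ≤ 1/2`, the mean of `W` below is at most `∑ j * 2⁻ʲ`.
  obtain ⟨k, hk, hk0⟩ := ((hlim.eventually (ge_mem_nhds
    (show (0 : ℝ≥0∞) < 2⁻¹ by simp))).and (eventually_gt_atTop 0)).exists
  set φ := ∫⁻ t : ℝ≥0, ENNReal.ofReal (Real.exp (-(k * t))) ∂G
  -- `W` sums `length * exp (length - k * time)` over all paths from the origin. If a path has `k *
  -- time ≤ length`, its own summand is already at least its length.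
  refine ⟨k, by exact_mod_cast hk0, fun τ => ∑' q : (Σ y, (lattice d).Path 0 y),
    q.2.1.length * (ENNReal.ofReal (Real.exp 1) ^ q.2.1.length *
      ENNReal.ofReal (Real.exp (-(k * walkTime q.2.1 τ)))), ?_, ?_⟩
  · have hm := fun (y : Fin d → ℤ) (q : (lattice d).Path 0 y) => measurable_walkTime_path q
    rw [lintegral_tsum fun q => by have := hm q.1 q.2; fun_prop]
    have hterm : ∀ q : (Σ y, (lattice d).Path 0 y),
        ∫⁻ τ, q.2.1.length * (ENNReal.ofReal (Real.exp 1) ^ q.2.1.length *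
          ENNReal.ofReal (Real.exp (-(k * walkTime q.2.1 τ)))) ∂(configLaw d G) =
        q.2.1.length * (ENNReal.ofReal (Real.exp 1) ^ q.2.1.length * φ ^ q.2.1.length) := by
      intro q
      have := hm q.1 q.2
      rw [lintegral_const_mul _ (by fun_prop), lintegral_const_mul _ (by fun_prop),
        lintegral_exp_neg_walkTime]
    simp only [hterm]
    refine ne_top_of_le_ne_top ?_ (tsum_path_le 0 fun k => k * (ENNReal.ofReal (Real.exp 1) ^ k * φ ^ k))
    have hle : ∀ j : ℕ, ((2 * d : ℕ) : ℝ≥0∞) ^ j * (j * (ENNReal.ofReal (Real.exp 1) ^ j * φ ^ j)) ≤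
        ENNReal.ofReal (j * (2⁻¹ : ℝ) ^ j) := by
      intro j
      calc ((2 * d : ℕ) : ℝ≥0∞) ^ j * (j * (ENNReal.ofReal (Real.exp 1) ^ j * φ ^ j))
          = j * (((2 * d : ℕ) : ℝ≥0∞) * ENNReal.ofReal (Real.exp 1) * φ) ^ j := by ring
        _ ≤ j * 2⁻¹ ^ j := by gcongr
        _ = ENNReal.ofReal (j * (2⁻¹ : ℝ) ^ j) := by
          rw [ENNReal.ofReal_mul (by positivity), ENNReal.ofReal_pow (by positivity),
            ENNReal.ofReal_natCast, ENNReal.ofReal_inv_of_pos two_pos, ENNReal.ofReal_ofNat]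
    refine ne_top_of_le_ne_top ?_ (ENNReal.tsum_le_tsum hle)
    have hs : Summable fun j : ℕ => (j : ℝ) * (2⁻¹ : ℝ) ^ j := by
      simpa using summable_pow_mul_geometric_of_norm_lt_one 1
        (show ‖(2⁻¹ : ℝ)‖ < 1 by norm_num)
    exact hs.tsum_ofReal_ne_top
  · intro τ y p
    refine le_trans ?_ (add_le_add_right (ENNReal.le_tsum (⟨y, p⟩ : Σ y, (lattice d).Path 0 y)) _)
    simp only
    rcases le_total (p.1.length : ℝ) (k * walkTime p.1 τ) with h | h
    · refine le_add_right ?_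
      rw [← ENNReal.ofReal_natCast]
      exact ENNReal.ofReal_le_ofReal h
    · refine le_add_left ?_
      conv_lhs => rw [← mul_one (p.1.length : ℝ≥0∞)]
      gcongr
      rw [← ENNReal.ofReal_pow (Real.exp_pos _).le, ← ENNReal.ofReal_mul (by positivity),
        ← Real.exp_nat_mul, ← Real.exp_add, ← ENNReal.ofReal_one]
      refine ENNReal.ofReal_le_ofReal (Real.one_le_exp ?_)
      linarith

theorem memLp_coord [IsProbabilityMeasure G] (hG2 : MemLp (fun t : ℝ≥0 => (t : ℝ)) 2 G)
    (e : Edge d) : MemLp (fun τ : Edge d → ℝ≥0 => (τ e : ℝ)) 2 (configLaw d G) :=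
  hG2.comp_measurePreserving (measurePreserving_eval_infinitePi (fun _ : Edge d => G) e)

theorem memLp_walkTime [IsProbabilityMeasure G] (hG2 : MemLp (fun t : ℝ≥0 => (t : ℝ)) 2 G)
    (p : (lattice d).Path x y) : MemLp (walkTime p.1) 2 (configLaw d G) := by
  rw [walkTime_path_eq_sum]
  exact memLp_finsetSum _ fun e _ => memLp_coord hG2 e

section FiniteFamily

variable {κ : Type*} (u : κ → (lattice d).Path x y) (s : Finset κ) (hs : s.Nonempty)

/-- The minimum of the passage times of a finite family of paths. -/
noncomputable def finMin (τ : Edge d → ℝ≥0) : ℝ := s.inf' hs fun i => walkTime (u i).1 τ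

theorem finMin_nonneg (τ : Edge d → ℝ≥0) : 0 ≤ finMin u s hs τ :=
  Finset.le_inf' _ _ fun _ _ => walkTime_nonneg _ _

theorem measurable_finMin : Measurable (finMin u s hs) := by
  have : Measurable (s.inf' hs fun i => walkTime (u i).1) :=
    Finset.inf'_induction hs _ (fun _ ha _ hb => ha.inf hb) fun i _ => measurable_walkTime_path (u i)
  convert this using 1
  funext τ
  rw [Finset.inf'_apply]
  rfl

theorem memLp_finMin [IsProbabilityMeasure G] (hG2 : MemLp (fun t : ℝ≥0 => (t : ℝ)) 2 G) :
    MemLp (finMin u s hs) 2 (configLaw d G) := by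
  obtain ⟨i, hi⟩ := id hs
  refine (memLp_walkTime hG2 (u i)).mono (measurable_finMin u s hs).aestronglyMeasurable
    (ae_of_all _ fun τ => ?_)
  rw [Real.norm_of_nonneg (finMin_nonneg _ _ _ _), Real.norm_of_nonneg (walkTime_nonneg _ _)]
  exact Finset.inf'_le _ hi

open Classical in
theorem finMin_congr {τ σ : Edge d → ℝ≥0}
    (h : ∀ e ∈ s.biUnion fun i => pathEdges (u i), τ e = σ e) :
    finMin u s hs τ = finMin u s hs σ := by
  refine Finset.inf'_congr hs rfl fun i hi => ?_
  simp only [walkTime_path_eq_sum]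
  refine Finset.sum_congr rfl fun e he => ?_
  rw [h e (Finset.mem_biUnion.2 ⟨i, hi, he⟩)]

open Classical in
-- Compare with the path that was minimal before the change: its time is unaffected off its edges,
-- and rises by at most `t` on them.
theorem finMin_update_le {i : κ} (hi : i ∈ s) {τ : Edge d → ℝ≥0}
    (hmin : finMin u s hs τ = walkTime (u i).1 τ) (e : Edge d) (t : ℝ≥0) :
    finMin u s hs (Function.update τ e t) - finMin u s hs τ ≤
      if e ∈ pathEdges (u i) then (t : ℝ) else 0 := by
  have h1 : finMin u s hs (Function.update τ e t) ≤ walkTime (u i).1 (Function.update τ e t) :=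
    Finset.inf'_le _ hi
  rw [hmin]
  simp only [walkTime_path_eq_sum] at h1 ⊢
  split_ifs with he
  · have h2 : ∑ e' ∈ pathEdges (u i), (Function.update τ e t e' : ℝ) ≤
        ∑ e' ∈ pathEdges (u i), ((τ e' : ℝ) + if e' = e then (t : ℝ) else 0) := by
      refine Finset.sum_le_sum fun e' _ => ?_
      by_cases h : e' = e
      · subst h; simp
      · simp [h]
    rw [Finset.sum_add_distrib, Finset.sum_ite_eq' , if_pos he] at h2
    linarith
  · have h2 : ∑ e' ∈ pathEdges (u i), (Function.update τ e t e' : ℝ) =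
        ∑ e' ∈ pathEdges (u i), (τ e' : ℝ) := by
      refine Finset.sum_congr rfl fun e' he' => ?_
      rw [Function.update_of_ne]
      rintro rfl
      exact he he'
    linarith

end FiniteFamily

/-- In Efron–Stein only the edges of a minimiser contribute, each at most the second moment of its
fresh time; `hW` then bounds the length of the minimiser. The bound does not depend on the family,
which permits the passage to all paths. -/
theorem variance_finMin_le [IsProbabilityMeasure G]
    (hG2 : MemLp (fun t : ℝ≥0 => (t : ℝ)) 2 G) {r : ℝ} (hr : 0 < r)
    {W : (Edge d → ℝ≥0) → ℝ≥0∞} (hWi : ∫⁻ τ, W τ ∂(configLaw d G) ≠ ∞)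
    (hW : ∀ (τ : Edge d → ℝ≥0) (y : Fin d → ℤ) (p : (lattice d).Path 0 y),
        (p.1.length : ℝ≥0∞) ≤ ENNReal.ofReal (r * walkTime p.1 τ) + W τ)
    {κ : Type*} (u : κ → (lattice d).Path 0 y) (s : Finset κ) (hs : s.Nonempty) :
    Var[finMin u s hs; configLaw d G] ≤ (∫ t : ℝ≥0, (t : ℝ) ^ 2 ∂G) *
      (r * ∫ τ, finMin u s hs τ ∂(configLaw d G) + (∫⁻ τ, W τ ∂(configLaw d G)).toReal) := by
  classical
  have hm := memLp_finMin u s hs hG2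
  set f := finMin u s hs with hf
  set A := s.biUnion fun i => pathEdges (u i) with hA
  set ν := configLaw d G with hν
  have hES := variance_le_sum_integral_sq_posPart hm A fun x y h => finMin_congr u s hs h
  have hfm : Measurable f := measurable_finMin u s hs
  have hmeas : ∀ e, Measurable fun z : (Edge d → ℝ≥0) × (Edge d → ℝ≥0) =>
      max (f (Function.update z.1 e (z.2 e)) - f z.1) 0 ^ 2 := by
    intro e
    have hup : Measurable fun z : (Edge d → ℝ≥0) × (Edge d → ℝ≥0) =>
        Function.update z.1 e (z.2 e) := by
      refine measurable_pi_lambda _ fun i => ?_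
      by_cases hi : i = e
      · subst hi; simp only [Function.update_self]; fun_prop
      · simp only [Function.update_of_ne hi]; fun_prop
    have := hfm.comp hup
    have h1 : Measurable fun z : (Edge d → ℝ≥0) × (Edge d → ℝ≥0) => f z.1 :=
      hfm.comp measurable_fst
    exact ((this.sub h1).max measurable_const).pow_const 2
  set M := ∫⁻ t : ℝ≥0, ENNReal.ofReal ((t : ℝ) ^ 2) ∂G with hM
  have hMfin : M ≠ ∞ := hG2.integrable_sq.lintegral_lt_top.ne
  have hMreal : (∫ t : ℝ≥0, (t : ℝ) ^ 2 ∂G) = M.toReal :=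
    integral_eq_lintegral_of_nonneg_ae (ae_of_all _ fun _ => sq_nonneg _)
      hG2.integrable_sq.aestronglyMeasurable
  have hfint : ENNReal.ofReal (r * ∫ τ, f τ ∂ν) = ∫⁻ τ, ENNReal.ofReal (r * f τ) ∂ν := by
    rw [← integral_const_mul]
    exact ofReal_integral_eq_lintegral_ofReal ((hm.integrable one_le_two).const_mul _)
      (ae_of_all _ fun τ => mul_nonneg hr.le (finMin_nonneg u s hs τ))
  have hE0 : 0 ≤ r * ∫ τ, f τ ∂ν :=
    mul_nonneg hr.le (integral_nonneg fun τ => finMin_nonneg u s hs τ)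
  have hmain : ∑ e ∈ A, ∫⁻ z : (Edge d → ℝ≥0) × (Edge d → ℝ≥0),
      ENNReal.ofReal (max (f (Function.update z.1 e (z.2 e)) - f z.1) 0 ^ 2) ∂(ν.prod ν) ≤
      M * (ENNReal.ofReal (r * ∫ τ, f τ ∂ν) + ∫⁻ τ, W τ ∂ν) := by
    rw [← lintegral_finsetSum _ fun e _ => (hmeas e).ennreal_ofReal,
      lintegral_prod _ (by
        exact (Finset.measurable_fun_sum _ fun e _ => (hmeas e).ennreal_ofReal).aemeasurable),
      hfint, ← lintegral_add_left (by fun_prop)]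
    rw [← lintegral_const_mul' _ _ hMfin]
    refine lintegral_mono fun τ => ?_
    -- The minimiser is chosen for fixed `τ`, before integrating over the independent `σ`, so no
    -- measurable selection is needed.
    obtain ⟨i, hi, hmin⟩ := Finset.exists_mem_eq_inf' hs fun i => walkTime (u i).1 τ
    have hmin' : f τ = walkTime (u i).1 τ := hmin
    calc ∫⁻ σ, ∑ e ∈ A, ENNReal.ofReal (max (f (Function.update τ e (σ e)) - f τ) 0 ^ 2) ∂ν
        ≤ ∫⁻ σ, ∑ e ∈ pathEdges (u i), ENNReal.ofReal ((σ e : ℝ) ^ 2) ∂ν := by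
          refine lintegral_mono fun σ => ?_
          have hsub : pathEdges (u i) ⊆ A := Finset.subset_biUnion_of_mem (fun i => pathEdges (u i)) hi
          rw [← Finset.sum_subset hsub (f := fun e =>
            ENNReal.ofReal (max (f (Function.update τ e (σ e)) - f τ) 0 ^ 2))]
          · refine Finset.sum_le_sum fun e he => ENNReal.ofReal_le_ofReal ?_
            have := finMin_update_le u s hs hi hmin' e (σ e)
            rw [if_pos he] at this
            exact pow_le_pow_left₀ (le_max_right _ _) (max_le this (NNReal.coe_nonneg _)) 2
          · intro e _ he
            have := finMin_update_le u s hs hi hmin' e (σ e)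
            rw [if_neg he] at this
            rw [max_eq_right this]
            simp
      _ = (u i).1.length * M := by
          rw [lintegral_finsetSum _ fun e _ => by fun_prop, ← card_pathEdges, ← nsmul_eq_mul,
            ← Finset.sum_const]
          refine Finset.sum_congr rfl fun e _ => ?_
          have h := measurePreserving_eval_infinitePi (fun _ : Edge d => G) e
          exact h.lintegral_comp (f := fun t : ℝ≥0 => ENNReal.ofReal ((t : ℝ) ^ 2)) (by fun_prop)
      _ ≤ M * (ENNReal.ofReal (r * f τ) + W τ) := by
          rw [mul_comm, hmin']
          gcongr
          exact hW τ _ (u i)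
  have hfinal : (∑ e ∈ A, ∫ z : (Edge d → ℝ≥0) × (Edge d → ℝ≥0),
      max (f (Function.update z.1 e (z.2 e)) - f z.1) 0 ^ 2 ∂(ν.prod ν)) =
      (∑ e ∈ A, ∫⁻ z : (Edge d → ℝ≥0) × (Edge d → ℝ≥0),
      ENNReal.ofReal (max (f (Function.update z.1 e (z.2 e)) - f z.1) 0 ^ 2) ∂(ν.prod ν)).toReal := by
    have hRfin : M * (ENNReal.ofReal (r * ∫ τ, f τ ∂ν) + ∫⁻ τ, W τ ∂ν) ≠ ∞ :=
      ENNReal.mul_ne_top hMfin (ENNReal.add_ne_top.2 ⟨ENNReal.ofReal_ne_top, hWi⟩)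
    rw [ENNReal.toReal_sum fun e he =>
      ((ENNReal.sum_ne_top.1 (ne_top_of_le_ne_top hRfin hmain)) e he)]
    refine Finset.sum_congr rfl fun e _ => ?_
    exact integral_eq_lintegral_of_nonneg_ae (ae_of_all _ fun _ => sq_nonneg _)
      (hmeas e).aestronglyMeasurable
  refine hES.trans ?_
  rw [hfinal, hMreal]
  refine (ENNReal.toReal_mono (ENNReal.mul_ne_top hMfin (ENNReal.add_ne_top.2
    ⟨ENNReal.ofReal_ne_top, hWi⟩)) hmain).trans_eq ?_
  rw [ENNReal.toReal_mul, ENNReal.toReal_add ENNReal.ofReal_ne_top hWi, ENNReal.toReal_ofReal hE0]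

/-- The minimum passage time in a configuration of nonnegative times. -/
noncomputable abbrev axisTime (n : ℕ) (τ : Edge d → ℝ≥0) : ℝ :=
  minPassageTime (fun e => (τ e : ℝ)) n

theorem axisTime_nonneg (n : ℕ) (τ : Edge d → ℝ≥0) : 0 ≤ axisTime n τ :=
  minPassageTime_nonneg (fun _ => NNReal.coe_nonneg _) n

theorem measurable_axisTime (n : ℕ) : Measurable (axisTime (d := d) n) :=
  Measurable.iInf fun p => measurable_walkTime_path p

theorem memLp_axisTime [IsProbabilityMeasure G] (hd : 0 < d)
    (hG2 : MemLp (fun t : ℝ≥0 => (t : ℝ)) 2 G) (n : ℕ) :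
    MemLp (axisTime n) 2 (configLaw d G) := by
  refine (memLp_finsetSum (Finset.range n) fun j _ => memLp_coord hG2 (axisEdge hd j)).mono
    (measurable_axisTime n).aestronglyMeasurable (ae_of_all _ fun τ => ?_)
  rw [Real.norm_of_nonneg (axisTime_nonneg n τ)]
  exact (minPassageTime_le hd (fun _ => NNReal.coe_nonneg _) n).trans (le_abs_self _)

/-- The infimum is the decreasing limit of minima over the first `N + 1` paths of an enumeration.
All are dominated by the time of the first path, so means and second moments converge. -/
theorem variance_axisTime_le [IsProbabilityMeasure G] (hd : 0 < d)
    (hG2 : MemLp (fun t : ℝ≥0 => (t : ℝ)) 2 G) {r : ℝ} (hr : 0 < r)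
    {W : (Edge d → ℝ≥0) → ℝ≥0∞} (hWi : ∫⁻ τ, W τ ∂(configLaw d G) ≠ ∞)
    (hW : ∀ (τ : Edge d → ℝ≥0) (y : Fin d → ℤ) (p : (lattice d).Path 0 y),
        (p.1.length : ℝ≥0∞) ≤ ENNReal.ofReal (r * walkTime p.1 τ) + W τ) (n : ℕ) :
    Var[axisTime n; configLaw d G] ≤ (∫ t : ℝ≥0, (t : ℝ) ^ 2 ∂G) *
      (r * ∫ τ, axisTime n τ ∂(configLaw d G) + (∫⁻ τ, W τ ∂(configLaw d G)).toReal) := by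
  have := nonempty_path_zero_axisPoint hd n
  obtain ⟨u, hu⟩ := exists_surjective_nat ((lattice d).Path 0 (axisPoint d n))
  have hne : ∀ N : ℕ, (Finset.range (N + 1)).Nonempty := fun N => Finset.nonempty_range_add_one
  set g : ℕ → (Edge d → ℝ≥0) → ℝ := fun N => finMin u (Finset.range (N + 1)) (hne N)
  have hg0 : ∀ N τ, 0 ≤ g N τ := fun N τ => finMin_nonneg u _ _ τ
  have hgle : ∀ N i τ, i ≤ N → g N τ ≤ walkTime (u i).1 τ := fun N i τ hi =>
    Finset.inf'_le _ (Finset.mem_range.2 (Nat.lt_succ_of_le hi))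
  have hlim : ∀ τ, Tendsto (fun N => g N τ) atTop (𝓝 (axisTime n τ)) := by
    intro τ
    have hb := bddBelow_passageTime (x := 0) (y := axisPoint d n)
      (fun e => NNReal.coe_nonneg (τ e))
    refine tendsto_order.2 ⟨fun a ha => Eventually.of_forall fun N => ha.trans_le ?_,
      fun a ha => ?_⟩
    · exact Finset.le_inf' _ _ fun i _ => ciInf_le hb (u i)
    · obtain ⟨p, hp⟩ := exists_lt_of_ciInf_lt ha
      obtain ⟨i, rfl⟩ := hu p
      filter_upwards [eventually_ge_atTop i] with N hN
      exact (hgle N i τ hN).trans_lt hp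
  have hmg : ∀ N, MemLp (g N) 2 (configLaw d G) := fun N => memLp_finMin u _ _ hG2
  have h0 := memLp_walkTime (G := G) hG2 (u 0)
  have hE : Tendsto (fun N => ∫ τ, g N τ ∂(configLaw d G)) atTop
      (𝓝 (∫ τ, axisTime n τ ∂(configLaw d G))) := by
    refine tendsto_integral_of_dominated_convergence (walkTime (u 0).1)
      (fun N => (hmg N).aestronglyMeasurable) (h0.integrable one_le_two)
      (fun N => ae_of_all _ fun τ => ?_) (ae_of_all _ hlim)
    rw [Real.norm_of_nonneg (hg0 N τ)]
    exact hgle N 0 τ (Nat.zero_le _)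
  have hE2 : Tendsto (fun N => ∫ τ, g N τ ^ 2 ∂(configLaw d G)) atTop
      (𝓝 (∫ τ, axisTime n τ ^ 2 ∂(configLaw d G))) := by
    refine tendsto_integral_of_dominated_convergence (fun τ => walkTime (u 0).1 τ ^ 2)
      (fun N => (hmg N).integrable_sq.aestronglyMeasurable) h0.integrable_sq
      (fun N => ae_of_all _ fun τ => ?_) (ae_of_all _ fun τ => (hlim τ).pow 2)
    rw [Real.norm_of_nonneg (sq_nonneg _)]
    exact pow_le_pow_left₀ (hg0 N τ) (hgle N 0 τ (Nat.zero_le _)) 2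
  have hV : Tendsto (fun N => Var[g N; configLaw d G]) atTop
      (𝓝 Var[axisTime n; configLaw d G]) := by
    rw [variance_eq_sub (memLp_axisTime hd hG2 n)]
    simp only [fun N => variance_eq_sub (hmg N)]
    exact hE2.sub (hE.pow 2)
  exact le_of_tendsto_of_tendsto' hV (((hE.const_mul r).add_const _).const_mul _)
    fun N => variance_finMin_le hG2 hr hWi hW u _ (hne N)

end Canonical

/-! ### The law of large numbers on the product space -/

section Limit

open scoped NNReal

theorem eLpNorm_two_eq_sqrt {Ω : Type*} [MeasurableSpace Ω] {P : Measure Ω} {f : Ω → ℝ}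
    (hf : MemLp f 2 P) : eLpNorm f 2 P = ENNReal.ofReal (√(∫ ω, f ω ^ 2 ∂P)) := by
  rw [hf.eLpNorm_eq_integral_rpow_norm (by norm_num) (by norm_num), Real.sqrt_eq_rpow]
  simp

/-- The sum of the squares has finite mean, hence is almost surely finite. -/
theorem ae_tendsto_zero_of_summable_integral_sq {Ω : Type*} [MeasurableSpace Ω] {P : Measure Ω}
    {X : ℕ → Ω → ℝ} (hX : ∀ k, MemLp (X k) 2 P) {c : ℕ → ℝ} (hc : Summable c)
    (hle : ∀ k, ∫ ω, X k ω ^ 2 ∂P ≤ c k) :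
    ∀ᵐ ω ∂P, Tendsto (fun k => X k ω) atTop (𝓝 0) := by
  have hmeas : ∀ k, AEMeasurable (fun ω => ENNReal.ofReal (X k ω ^ 2)) P := fun k =>
    (hX k).integrable_sq.aestronglyMeasurable.aemeasurable.ennreal_ofReal
  have hfin : ∫⁻ ω, ∑' k, ENNReal.ofReal (X k ω ^ 2) ∂P ≠ ∞ := by
    rw [lintegral_tsum hmeas]
    refine ne_top_of_le_ne_top hc.tsum_ofReal_ne_top (ENNReal.tsum_le_tsum fun k => ?_)
    rw [← ofReal_integral_eq_lintegral_ofReal (hX k).integrable_sq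
      (ae_of_all _ fun _ => sq_nonneg _)]
    exact ENNReal.ofReal_le_ofReal (hle k)
  filter_upwards [ae_lt_top' (AEMeasurable.tsum hmeas) hfin] with ω hω
  have h := ENNReal.tendsto_atTop_zero_of_tsum_ne_top hω.ne
  have h2 : Tendsto (fun k => X k ω ^ 2) atTop (𝓝 0) := by
    have := (ENNReal.tendsto_toReal ENNReal.zero_ne_top).comp h
    simpa [Function.comp_def, ENNReal.toReal_ofReal, sq_nonneg] using this
  have h3 := h2.sqrt
  simp only [Real.sqrt_sq_eq_abs, Real.sqrt_zero] at h3
  exact tendsto_zero_iff_abs_tendsto_zero _ |>.2 h3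

/-- A sequence whose increments are small between consecutive squares grows linearly as soon as it
does so along the squares. -/
theorem tendsto_div_of_tendsto_div_sq {T b : ℕ → ℝ} {μ : ℝ} (hb : ∀ j, 0 ≤ b j)
    (hT : ∀ m n, m ≤ n → |T n - T m| ≤ ∑ j ∈ Finset.Ico m n, b j)
    (hsq : Tendsto (fun k : ℕ => T ((k + 1) ^ 2) / ((k + 1 : ℕ) : ℝ) ^ 2 - μ) atTop (𝓝 0))
    (hinc : Tendsto (fun k : ℕ => (∑ j ∈ Finset.Ico ((k + 1) ^ 2) ((k + 2) ^ 2), b j) /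
      ((k + 1 : ℕ) : ℝ) ^ 2) atTop (𝓝 0)) :
    Tendsto (fun n : ℕ => T n / (n : ℝ)) atTop (𝓝 μ) := by
  have hinv : Tendsto (fun k : ℕ => |μ| * (3 * ((k + 1 : ℕ) : ℝ)⁻¹)) atTop (𝓝 0) := by
    have h := tendsto_inv_atTop_nhds_zero_nat (𝕜 := ℝ)
    simpa using ((h.comp (tendsto_add_atTop_nat 1)).const_mul 3).const_mul |μ|
  have hbound := (hinc.add hsq.abs).add hinv
  simp only [abs_zero, add_zero] at hbound
  -- For `n ≥ 1`, take `k + 1 = ⌊√n⌋`, so that `(k + 1)² ≤ n < (k + 2)²`.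
  have hk : Tendsto (fun n : ℕ => n.sqrt - 1) atTop atTop := by
    refine tendsto_atTop.2 fun m => ?_
    filter_upwards [eventually_ge_atTop ((m + 1) * (m + 1))] with n hn
    exact Nat.le_sub_of_add_le (Nat.le_sqrt.2 hn)
  rw [tendsto_iff_norm_sub_tendsto_zero]
  refine squeeze_zero' (Eventually.of_forall fun _ => norm_nonneg _) ?_ (hbound.comp hk)
  filter_upwards [eventually_ge_atTop 1] with n hn
  obtain ⟨k, hkn⟩ : ∃ k, n.sqrt = k + 1 :=
    Nat.exists_eq_succ_of_ne_zero (Nat.sqrt_pos.2 hn).ne'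
  have h1 : (k + 1) ^ 2 ≤ n := by rw [← hkn]; exact Nat.sqrt_le' n
  have h2 : n < (k + 2) ^ 2 := by
    have := Nat.lt_succ_sqrt' n
    rwa [hkn] at this
  simp only [Function.comp, hkn, Nat.add_sub_cancel]
  set a : ℝ := ((k + 1 : ℕ) : ℝ) with ha
  have ha1 : 1 ≤ a := by rw [ha]; push_cast; linarith [(Nat.cast_nonneg k : (0 : ℝ) ≤ k)]
  have h1' : a ^ 2 ≤ n := by rw [ha]; exact_mod_cast h1
  -- From `n < (a + 1)²` and `1 ≤ a`; this is the source of the factor `3` in `hinv`.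
  have h2' : (n : ℝ) ≤ a ^ 2 + 3 * a := by
    have : (n : ℝ) < ((k + 2 : ℕ) : ℝ) ^ 2 := by exact_mod_cast h2
    have e : ((k + 2 : ℕ) : ℝ) = a + 1 := by rw [ha]; push_cast; ring
    rw [e] at this
    nlinarith
  have hn0 : (0 : ℝ) < n := by exact_mod_cast hn
  have ha2 : 0 < a ^ 2 := by positivity
  set S := ∑ j ∈ Finset.Ico ((k + 1) ^ 2) ((k + 2) ^ 2), b j
  have hS0 : 0 ≤ S := Finset.sum_nonneg fun j _ => hb j
  have hTn : |T n - T ((k + 1) ^ 2)| ≤ S :=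
    (hT _ _ h1).trans (Finset.sum_le_sum_of_subset_of_nonneg
      (Finset.Ico_subset_Ico le_rfl h2.le) fun j _ _ => hb j)
  have hnum : |T n - μ * n| ≤ S + |T ((k + 1) ^ 2) - μ * a ^ 2| + |μ| * (3 * a) := by
    have e : T n - μ * n = (T n - T ((k + 1) ^ 2)) + (T ((k + 1) ^ 2) - μ * a ^ 2) +
        μ * (a ^ 2 - n) := by ring
    rw [e]
    refine (abs_add_three _ _ _).trans ?_
    have : |μ * (a ^ 2 - n)| ≤ |μ| * (3 * a) := by
      rw [abs_mul]
      gcongr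
      rw [abs_le]
      constructor <;> linarith
    linarith
  calc ‖T n / n - μ‖ = |T n - μ * n| / n := by
        rw [Real.norm_eq_abs, ← abs_of_pos hn0, ← abs_div, abs_of_pos hn0]
        congr 1
        field_simp
    _ ≤ (S + |T ((k + 1) ^ 2) - μ * a ^ 2| + |μ| * (3 * a)) / a ^ 2 := by gcongr
    _ = S / a ^ 2 + |T ((k + 1) ^ 2) / a ^ 2 - μ| + |μ| * (3 * a⁻¹) := by
        have e : T ((k + 1) ^ 2) / a ^ 2 - μ = (T ((k + 1) ^ 2) - μ * a ^ 2) / a ^ 2 := by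
          field_simp
        rw [e, abs_div, abs_of_pos ha2]
        field_simp

variable {d : ℕ} {G : Measure ℝ≥0} [IsProbabilityMeasure G]

theorem measurePreserving_translate (v : Fin d → ℤ) :
    MeasurePreserving (fun (τ : Edge d → ℝ≥0) e => τ ((translate v).mapEdgeSet e))
      (configLaw d G) (configLaw d G) := by
  refine ⟨by fun_prop, Measure.map_infinitePi_infinitePi_of_inj (P := fun _ : Edge d => G) ?_⟩
  refine SimpleGraph.Hom.mapEdgeSet.injective _ fun x y h => ?_
  exact add_right_cancel (h : x + v = y + v)

theorem subadditive_integral_axisTime (hd : 0 < d)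
    (hG2 : MemLp (fun t : ℝ≥0 => (t : ℝ)) 2 G) :
    Subadditive fun n => ∫ τ, axisTime n τ ∂(configLaw d G) := by
  intro m n
  have hint : ∀ n, Integrable (axisTime n) (configLaw d G) := fun n =>
    (memLp_axisTime hd hG2 n).integrable one_le_two
  have hmp := measurePreserving_translate (G := G) (axisPoint d m)
  have hshift : Integrable (fun τ : Edge d → ℝ≥0 =>
      axisTime n fun e => τ ((translate (axisPoint d m)).mapEdgeSet e)) (configLaw d G) :=
    hmp.integrable_comp_of_integrable (hint n)
  have heq : ∫ τ : Edge d → ℝ≥0, axisTime n (fun e => τ ((translate (axisPoint d m)).mapEdgeSet e))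
      ∂(configLaw d G) = ∫ τ, axisTime n τ ∂(configLaw d G) := by
    conv_rhs => rw [← hmp.map_eq]
    rw [integral_map hmp.measurable.aemeasurable
      (measurable_axisTime n).aestronglyMeasurable]
  simp only
  rw [← heq, ← integral_add (hint m) hshift]
  exact integral_mono (hint _) ((hint m).add hshift) fun τ =>
    minPassageTime_add_le hd (fun _ => NNReal.coe_nonneg _) m n

theorem integral_axisTime_le (hd : 0 < d) (hG2 : MemLp (fun t : ℝ≥0 => (t : ℝ)) 2 G) (n : ℕ) :
    ∫ τ, axisTime n τ ∂(configLaw d G) ≤ n * ∫ t : ℝ≥0, (t : ℝ) ∂G := by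
  have hint : ∀ e : Edge d, Integrable (fun τ : Edge d → ℝ≥0 => (τ e : ℝ)) (configLaw d G) :=
    fun e => (memLp_coord hG2 e).integrable one_le_two
  have hval : ∀ e : Edge d, ∫ τ : Edge d → ℝ≥0, (τ e : ℝ) ∂(configLaw d G) =
      ∫ t : ℝ≥0, (t : ℝ) ∂G := by
    intro e
    have h := measurePreserving_eval_infinitePi (fun _ : Edge d => G) e
    conv_rhs => rw [← h.map_eq]
    rw [integral_map h.measurable.aemeasurable (by fun_prop)]
  calc ∫ τ, axisTime n τ ∂(configLaw d G)
      ≤ ∫ τ : Edge d → ℝ≥0, ∑ j ∈ Finset.range n, (τ (axisEdge hd j) : ℝ) ∂(configLaw d G) :=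
        integral_mono ((memLp_axisTime hd hG2 n).integrable one_le_two)
          (integrable_finsetSum _ fun j _ => hint _)
          fun τ => minPassageTime_le hd (fun _ => NNReal.coe_nonneg _) n
    _ = n * ∫ t : ℝ≥0, (t : ℝ) ∂G := by
        rw [integral_finsetSum _ fun j _ => hint _]
        simp [hval]

/-- Every competing path has at least `n` edges, so `n ≤ r * T_n + W` pointwise. This linear lower
bound on the mean makes the time constant positive. -/
theorem le_integral_axisTime (hd : 0 < d) (hG2 : MemLp (fun t : ℝ≥0 => (t : ℝ)) 2 G)
    {r : ℝ} (hr : 0 < r) {W : (Edge d → ℝ≥0) → ℝ≥0∞}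
    (hWi : ∫⁻ τ, W τ ∂(configLaw d G) ≠ ∞)
    (hW : ∀ (τ : Edge d → ℝ≥0) (y : Fin d → ℤ) (p : (lattice d).Path 0 y),
        (p.1.length : ℝ≥0∞) ≤ ENNReal.ofReal (r * walkTime p.1 τ) + W τ) (n : ℕ) :
    (n : ℝ) ≤ r * ∫ τ, axisTime n τ ∂(configLaw d G) +
      (∫⁻ τ, W τ ∂(configLaw d G)).toReal := by
  have hpt : ∀ τ : Edge d → ℝ≥0, (n : ℝ≥0∞) ≤ ENNReal.ofReal (r * axisTime n τ) + W τ := by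
    intro τ
    by_cases hτ : W τ = ∞
    · simp [hτ]
    have hne := nonempty_path_zero_axisPoint hd n
    have hlow : ((n : ℝ) - (W τ).toReal) / r ≤ axisTime n τ := by
      refine le_ciInf fun p => ?_
      have h1 : (n : ℝ≥0∞) ≤ ENNReal.ofReal (r * walkTime p.1 τ) + W τ :=
        le_trans (by exact_mod_cast le_length_of_walk_axisPoint hd p.1) (hW τ _ p)
      have h2 := ENNReal.toReal_mono (ENNReal.add_ne_top.2 ⟨ENNReal.ofReal_ne_top, hτ⟩) h1
      rw [ENNReal.toReal_add ENNReal.ofReal_ne_top hτ, ENNReal.toReal_natCast,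
        ENNReal.toReal_ofReal (mul_nonneg hr.le (walkTime_nonneg _ _))] at h2
      rw [div_le_iff₀ hr, mul_comm]
      exact sub_le_iff_le_add.2 h2
    rw [div_le_iff₀ hr, mul_comm] at hlow
    rw [← ENNReal.ofReal_toReal hτ, ← ENNReal.ofReal_add
      (mul_nonneg hr.le (axisTime_nonneg n τ)) ENNReal.toReal_nonneg, ← ENNReal.ofReal_natCast]
    exact ENNReal.ofReal_le_ofReal (by linarith)
  have hE0 : 0 ≤ r * ∫ τ, axisTime n τ ∂(configLaw d G) :=
    mul_nonneg hr.le (integral_nonneg fun τ => axisTime_nonneg n τ)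
  have hint : (n : ℝ≥0∞) ≤ ENNReal.ofReal (r * ∫ τ, axisTime n τ ∂(configLaw d G)) +
      ∫⁻ τ, W τ ∂(configLaw d G) := by
    have hm := measurable_axisTime (d := d) n
    rw [← integral_const_mul, ofReal_integral_eq_lintegral_ofReal
      (((memLp_axisTime hd hG2 n).integrable one_le_two).const_mul _)
      (ae_of_all _ fun τ => mul_nonneg hr.le (axisTime_nonneg n τ)),
      ← lintegral_add_left (hm.const_mul r).ennreal_ofReal]
    calc (n : ℝ≥0∞) = ∫⁻ _, (n : ℝ≥0∞) ∂(configLaw d G) := by simp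
      _ ≤ _ := lintegral_mono hpt
  have := ENNReal.toReal_mono (ENNReal.add_ne_top.2 ⟨ENNReal.ofReal_ne_top, hWi⟩) hint
  rwa [ENNReal.toReal_add ENNReal.ofReal_ne_top hWi, ENNReal.toReal_natCast,
    ENNReal.toReal_ofReal hE0] at this

/-- Cauchy–Schwarz. The quadratic dependence on the number of edges is affordable: the windows
between consecutive squares have `O(k)` edges and the sums are divided by `k²`. -/
theorem integral_sq_axisSum_le (hd : 0 < d) (hG2 : MemLp (fun t : ℝ≥0 => (t : ℝ)) 2 G)
    (s : Finset ℕ) :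
    ∫ τ : Edge d → ℝ≥0, (∑ j ∈ s, (τ (axisEdge hd j) : ℝ)) ^ 2 ∂(configLaw d G) ≤
      (s.card : ℝ) ^ 2 * ∫ t : ℝ≥0, (t : ℝ) ^ 2 ∂G := by
  have hint : ∀ e : Edge d, Integrable (fun τ : Edge d → ℝ≥0 => (τ e : ℝ) ^ 2) (configLaw d G) :=
    fun e => (memLp_coord hG2 e).integrable_sq
  have hval : ∀ e : Edge d, ∫ τ : Edge d → ℝ≥0, (τ e : ℝ) ^ 2 ∂(configLaw d G) =
      ∫ t : ℝ≥0, (t : ℝ) ^ 2 ∂G := by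
    intro e
    have h := measurePreserving_eval_infinitePi (fun _ : Edge d => G) e
    conv_rhs => rw [← h.map_eq]
    rw [integral_map h.measurable.aemeasurable (by fun_prop)]
  calc ∫ τ : Edge d → ℝ≥0, (∑ j ∈ s, (τ (axisEdge hd j) : ℝ)) ^ 2 ∂(configLaw d G)
      ≤ ∫ τ : Edge d → ℝ≥0, s.card * ∑ j ∈ s, (τ (axisEdge hd j) : ℝ) ^ 2 ∂(configLaw d G) :=
        integral_mono (memLp_finsetSum _ fun j _ => memLp_coord hG2 (axisEdge hd j)).integrable_sq
          ((integrable_finsetSum _ fun j _ => hint _).const_mul _) fun τ => sq_sum_le_card_mul_sum_sq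
    _ = (s.card : ℝ) ^ 2 * ∫ t : ℝ≥0, (t : ℝ) ^ 2 ∂G := by
        rw [integral_const_mul, integral_finsetSum _ fun j _ => hint _]
        simp only [hval, Finset.sum_const, nsmul_eq_mul]
        ring

/-- The law of large numbers for the minimum passage times of an i.i.d. configuration of
almost surely positive, square integrable times. -/
theorem exists_timeConstant (hd : 0 < d) (hG : G {0} = 0)
    (hG2 : MemLp (fun t : ℝ≥0 => (t : ℝ)) 2 G) :
    ∃ μ : ℝ, 0 < μ ∧
      (∀ᵐ τ ∂(configLaw d G), Tendsto (fun n : ℕ => axisTime n τ / (n : ℝ)) atTop (𝓝 μ)) ∧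
      Tendsto (fun n : ℕ => eLpNorm (fun τ => axisTime n τ / (n : ℝ) - μ) 2 (configLaw d G))
        atTop (𝓝 0) := by
  obtain ⟨r, hr, W, hWi, hW⟩ := exists_length_le_walkTime (d := d) hG
  set ν := configLaw d G
  set w := (∫⁻ τ, W τ ∂ν).toReal
  set m₁ := ∫ t : ℝ≥0, (t : ℝ) ∂G
  set m₂ := ∫ t : ℝ≥0, (t : ℝ) ^ 2 ∂G
  have hm₁ : 0 ≤ m₁ := integral_nonneg fun t => NNReal.coe_nonneg t
  have hm₂ : 0 ≤ m₂ := integral_nonneg fun t => sq_nonneg _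
  have hw : 0 ≤ w := ENNReal.toReal_nonneg
  set E : ℕ → ℝ := fun n => ∫ τ, axisTime n τ ∂ν with hE
  have hsub : Subadditive E := subadditive_integral_axisTime hd hG2
  have hE0 : ∀ n, 0 ≤ E n := fun n => integral_nonneg fun τ => axisTime_nonneg n τ
  have hlimE : Tendsto (fun n => E n / n) atTop (𝓝 hsub.lim) := hsub.tendsto_lim
    ⟨0, by rintro _ ⟨n, rfl⟩; exact div_nonneg (hE0 n) (Nat.cast_nonneg n)⟩
  set μ := hsub.lim
  have hmem : ∀ n, MemLp (axisTime n) 2 ν := fun n => memLp_axisTime hd hG2 n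
  -- Dividing `n ≤ r * E n + w` by `n` gives `1 ≤ r * μ` in the limit.
  have hpos : 0 < μ := by
    have h1 : Tendsto (fun n : ℕ => r * (E n / n) + w * (n : ℝ)⁻¹) atTop (𝓝 (r * μ + w * 0)) :=
      (hlimE.const_mul r).add ((tendsto_inv_atTop_nhds_zero_nat (𝕜 := ℝ)).const_mul w)
    have h2 : 1 ≤ r * μ + w * 0 := by
      refine ge_of_tendsto h1 ?_
      filter_upwards [eventually_ge_atTop 1] with n hn
      have hn0 : (0 : ℝ) < n := by exact_mod_cast hn
      have h3 : (n : ℝ) ≤ r * E n + w := le_integral_axisTime hd hG2 hr hWi hW n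
      rw [← div_eq_mul_inv, ← mul_div_assoc, ← add_div, le_div_iff₀ hn0]
      linarith
    by_contra hcon
    nlinarith [not_lt.1 hcon]
  set C := m₂ * (r * m₁ + w)
  have hC : 0 ≤ C := by positivity
  have hvar : ∀ n : ℕ, 1 ≤ n → Var[axisTime n; ν] ≤ C * n := by
    intro n hn
    have hn' : (1 : ℝ) ≤ n := by exact_mod_cast hn
    calc Var[axisTime n; ν] ≤ m₂ * (r * E n + w) := variance_axisTime_le hd hG2 hr hWi hW n
      _ ≤ m₂ * (r * (n * m₁) + w * n) := by
        gcongr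
        · exact integral_axisTime_le hd hG2 n
        · exact le_mul_of_one_le_right hw hn'
      _ = C * n := by ring
  have hcent : ∀ n : ℕ, 1 ≤ n → ∫ τ, ((axisTime n τ - E n) / n) ^ 2 ∂ν ≤ C * (n : ℝ)⁻¹ := by
    intro n hn
    have hn0 : (0 : ℝ) < n := by exact_mod_cast hn
    simp only [div_pow]
    rw [integral_div, ← variance_eq_integral (hmem n).aemeasurable, div_le_iff₀ (by positivity)]
    refine (hvar n hn).trans_eq ?_
    field_simp
  have hcentmem : ∀ n, MemLp (fun τ => (axisTime n τ - E n) / n) 2 ν := fun n => by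
    simp only [div_eq_mul_inv]
    exact ((hmem n).sub (memLp_const _)).mul_const _
  refine ⟨μ, hpos, ?_, ?_⟩
  -- At `n = (k + 1)²` the bound `C / n` on the centred second moment is summable in `k`.
  · have hsum : Summable fun k : ℕ => (((k + 1 : ℕ) : ℝ) ^ 2)⁻¹ :=
      (summable_nat_add_iff 1 (f := fun k : ℕ => ((k : ℝ) ^ 2)⁻¹)).2
        (Real.summable_nat_pow_inv.2 one_lt_two)
    have hA := ae_tendsto_zero_of_summable_integral_sq
      (X := fun k τ => (axisTime ((k + 1) ^ 2) τ - E ((k + 1) ^ 2)) / (((k + 1) ^ 2 : ℕ) : ℝ))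
      (fun k => hcentmem _) (hsum.mul_left C) fun k => by
        simpa using hcent ((k + 1) ^ 2) (Nat.one_le_pow _ _ (Nat.succ_pos k))
    have hB := ae_tendsto_zero_of_summable_integral_sq (P := ν)
      (X := fun k τ => (∑ j ∈ Finset.Ico ((k + 1) ^ 2) ((k + 2) ^ 2), (τ (axisEdge hd j) : ℝ)) /
        ((k + 1 : ℕ) : ℝ) ^ 2)
      (fun k => by
        simp only [div_eq_mul_inv]
        exact (memLp_finsetSum _ fun j _ => memLp_coord hG2 (axisEdge hd j)).mul_const _)
      -- The window has `2k + 3 ≤ 3(k + 1)` edges, hence the `9 = 3²`.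
      (hsum.mul_left (9 * m₂)) fun k => by
        simp only [div_pow]
        rw [integral_div]
        have h1 := integral_sq_axisSum_le hd hG2 (Finset.Ico ((k + 1) ^ 2) ((k + 2) ^ 2))
        have hcard : ((Finset.Ico ((k + 1) ^ 2) ((k + 2) ^ 2)).card : ℝ) ≤ 3 * ((k + 1 : ℕ) : ℝ) := by
          rw [Nat.card_Ico]
          have : (k + 2) ^ 2 - (k + 1) ^ 2 ≤ 3 * (k + 1) := by
            rw [Nat.sub_le_iff_le_add]; nlinarith
          exact_mod_cast this
        have ha : (0 : ℝ) < ((k + 1 : ℕ) : ℝ) := by positivity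
        rw [div_le_iff₀ (by positivity)]
        calc _ ≤ _ := h1
          _ ≤ (3 * ((k + 1 : ℕ) : ℝ)) ^ 2 * m₂ := by gcongr
          _ = _ := by field_simp; ring
    have hEsq : Tendsto (fun k : ℕ => E ((k + 1) ^ 2) / (((k + 1) ^ 2 : ℕ) : ℝ)) atTop (𝓝 μ) := by
      refine hlimE.comp (tendsto_atTop_mono (fun k => ?_) tendsto_id)
      simp only [id]
      nlinarith
    filter_upwards [hA, hB] with τ hτA hτB
    refine tendsto_div_of_tendsto_div_sq (b := fun j => (τ (axisEdge hd j) : ℝ))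
      (fun j => NNReal.coe_nonneg _)
      (fun m n hmn => abs_minPassageTime_sub_le hd (fun _ => NNReal.coe_nonneg _) hmn) ?_ hτB
    have := (hτA.add hEsq).sub_const μ
    rw [zero_add, sub_self] at this
    refine this.congr fun k => ?_
    push_cast
    ring
  · have hmem' : ∀ n : ℕ, MemLp (fun τ => axisTime n τ / (n : ℝ) - μ) 2 ν := fun n => by
      simp only [div_eq_mul_inv]
      exact ((hmem n).mul_const _).sub (memLp_const _)
    simp only [fun n => eLpNorm_two_eq_sqrt (hmem' n)]
    rw [← ENNReal.ofReal_zero, ← Real.sqrt_zero]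
    refine ENNReal.tendsto_ofReal (Tendsto.sqrt ?_)
    -- Fluctuation about the mean, plus the deterministic error of `E n / n`.
    have hup : Tendsto (fun n : ℕ => 2 * (C * (n : ℝ)⁻¹) + 2 * (E n / n - μ) ^ 2) atTop (𝓝 0) := by
      have h1 := ((tendsto_inv_atTop_nhds_zero_nat (𝕜 := ℝ)).const_mul C).const_mul 2
      have h2 := ((hlimE.sub_const μ).pow 2).const_mul 2
      simpa using h1.add h2
    refine squeeze_zero' (Eventually.of_forall fun n => integral_nonneg fun τ => sq_nonneg _) ?_ hup
    filter_upwards [eventually_ge_atTop 1] with n hn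
    have hi := (hcentmem n).integrable_sq
    calc ∫ τ, (axisTime n τ / n - μ) ^ 2 ∂ν
        ≤ ∫ τ, (2 * ((axisTime n τ - E n) / n) ^ 2 + 2 * (E n / n - μ) ^ 2) ∂ν := by
          refine integral_mono (hmem' n).integrable_sq ((hi.const_mul 2).add (integrable_const _))
            fun τ => ?_
          have e : axisTime n τ / n - μ = (axisTime n τ - E n) / n + (E n / n - μ) := by ring
          simp only
          rw [e]
          nlinarith [sq_nonneg ((axisTime n τ - E n) / n - (E n / n - μ))]
      _ = 2 * ∫ τ, ((axisTime n τ - E n) / n) ^ 2 ∂ν + 2 * (E n / n - μ) ^ 2 := by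
          rw [integral_add (hi.const_mul 2) (integrable_const _), integral_const_mul]
          simp
      _ ≤ _ := by
          gcongr
          exact hcent n hn

end Limit

/-! ### From the hypotheses on `t` to the common law -/

section Transfer

variable {d : ℕ} {F : Measure ℝ} {Ω : Type*} [MeasurableSpace Ω] {P : Measure Ω}
  {t : Edge d → Ω → ℝ}

/-- The event `t ≤ 0` lies in `t < ε` for every `ε > 0`. -/
theorem law_Iic_zero_of_smallTimesUnlikely (ht : ∀ e, Measurable (t e))
    (hF : ∀ e, P.map (t e) = F) (e : Edge d) (hs : SmallTimesUnlikely P t) :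
    F (Set.Iic 0) = 0 := by
  rw [← hF e, Measure.map_apply (ht e) measurableSet_Iic]
  refine le_antisymm (ge_of_tendsto hs ?_) zero_le
  filter_upwards [self_mem_nhdsWithin] with ε hε
  refine le_trans (measure_mono fun ω hω => ?_) (le_iSup (fun e => P {ω | t e ω < ε}) e)
  exact lt_of_le_of_lt (show t e ω ≤ 0 from hω) (Set.mem_Ioi.1 hε)

theorem memLp_id_of_boundedSecondMoment (ht : ∀ e, Measurable (t e))
    (hF : ∀ e, P.map (t e) = F) (e : Edge d) (hb : BoundedSecondMoment P t) :
    MemLp (fun x : ℝ => x) 2 F := by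
  rw [memLp_two_iff_integrable_sq (by fun_prop)]
  refine ⟨by fun_prop, ?_⟩
  rw [hasFiniteIntegral_iff_ofReal (ae_of_all _ fun x => sq_nonneg _), ← hF e,
    lintegral_map (by fun_prop) (ht e)]
  exact (le_iSup (fun e => ∫⁻ ω, ENNReal.ofReal (t e ω ^ 2) ∂P) e).trans_lt hb

end Transfer

end FirstPassage

theorem corollary1 (d : ℕ) (hd : 2 ≤ d) (F : Measure ℝ) [IsProbabilityMeasure F] :
    ∃ μF : ℝ, 0 < μF ∧
      ∀ (Ω : Type*) [MeasurableSpace Ω] (P : Measure Ω) [IsProbabilityMeasure P]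
        (t : FirstPassage.Edge d → Ω → ℝ),
        (∀ e, Measurable (t e)) → iIndepFun t P → (∀ e, P.map (t e) = F) →
        FirstPassage.SmallTimesUnlikely P t → FirstPassage.BoundedSecondMoment P t →
        (∀ᵐ ω ∂P, Tendsto
          (fun n : ℕ => FirstPassage.minPassageTime (fun e => t e ω) n / (n : ℝ))
          atTop (𝓝 μF)) ∧
        (∀ n : ℕ, MemLp (fun ω => FirstPassage.minPassageTime (fun e => t e ω) n) 2 P) ∧
        Tendsto
          (fun n : ℕ => eLpNorm
            (fun ω => FirstPassage.minPassageTime (fun e => t e ω) n / (n : ℝ) - μF) 2 P)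
          atTop (𝓝 0) := by
  have hd0 : 0 < d := by omega
  by_cases hF : F (Set.Iic 0) = 0 ∧ MemLp (fun x : ℝ => x) 2 F
  swap
  -- The constant is chosen before the probability space. If `F` fails either condition, no family
  -- `t` meets the hypotheses, and `1` is an arbitrary value.
  · refine ⟨1, one_pos, fun Ω _ P _ t ht _ hlaw hs hb => absurd ?_ hF⟩
    have e := FirstPassage.axisEdge hd0 0
    exact ⟨FirstPassage.law_Iic_zero_of_smallTimesUnlikely ht hlaw e hs,
      FirstPassage.memLp_id_of_boundedSecondMoment ht hlaw e hb⟩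
  obtain ⟨hF0, hF2⟩ := hF
  have hmG : Measurable Real.toNNReal := measurable_real_toNNReal
  -- Truncation at zero loses nothing, since `F` gives no mass to `(-∞, 0]`.
  set G := F.map Real.toNNReal
  have : IsProbabilityMeasure G := Measure.isProbabilityMeasure_map hmG.aemeasurable
  have hG : G {0} = 0 := by
    rw [Measure.map_apply hmG (measurableSet_singleton 0)]
    refine measure_mono_null (fun x hx => ?_) hF0
    simpa using hx
  have hG2 : MemLp (fun s : NNReal => (s : ℝ)) 2 G := by
    rw [memLp_map_measure_iff (by fun_prop) hmG.aemeasurable]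
    refine hF2.mono (by fun_prop) (ae_of_all _ fun x => ?_)
    simp only [Function.comp, Real.coe_toNNReal', Real.norm_eq_abs]
    exact abs_max_le_max_abs_abs.trans (by simp)
  obtain ⟨μ, hμ, hae, hL2⟩ := FirstPassage.exists_timeConstant hd0 hG hG2
  refine ⟨μ, hμ, fun Ω _ P _ t ht hind hlaw _ _ => ?_⟩
  -- Independence and the common law determine the joint law, so the limits carry over from the
  -- product space.
  have hX : MeasurePreserving (fun ω e => (t e ω).toNNReal) P (FirstPassage.configLaw d G) := by
    have hm : ∀ e, Measurable fun ω => (t e ω).toNNReal := fun e => hmG.comp (ht e)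
    refine ⟨measurable_pi_lambda _ hm, ?_⟩
    rw [(hind.comp (fun _ => Real.toNNReal) fun _ => hmG).map_fun_eq_infinitePi_map hm]
    congr 1
    funext e
    change P.map (Real.toNNReal ∘ t e) = _
    rw [← Measure.map_map hmG (ht e), hlaw e]
  have hpos : ∀ᵐ ω ∂P, ∀ e, ((t e ω).toNNReal : ℝ) = t e ω := by
    refine ae_all_iff.2 fun e => ?_
    have h0 : ∀ᵐ x ∂(P.map (t e)), x ∉ Set.Iic (0 : ℝ) := by
      rw [hlaw e]
      exact measure_eq_zero_iff_ae_notMem.1 hF0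
    filter_upwards [ae_of_ae_map (ht e).aemeasurable h0] with ω hω
    exact Real.coe_toNNReal _ (not_le.1 hω).le
  have heq : ∀ᵐ ω ∂P, ∀ n, FirstPassage.axisTime n (fun e => (t e ω).toNNReal) =
      FirstPassage.minPassageTime (fun e => t e ω) n := by
    filter_upwards [hpos] with ω hω n
    simp only [FirstPassage.axisTime, hω]
  refine ⟨?_, fun n => ?_, ?_⟩
  · filter_upwards [hX.quasiMeasurePreserving.ae hae, heq] with ω h1 h2
    simpa only [h2] using h1
  · refine ((FirstPassage.memLp_axisTime hd0 hG2 n).comp_measurePreserving hX).ae_eq ?_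
    filter_upwards [heq] with ω hω using hω n
  · refine hL2.congr fun n => ?_
    have hm : AEStronglyMeasurable (fun τ => FirstPassage.axisTime (d := d) n τ / (n : ℝ) - μ)
        (FirstPassage.configLaw d G) :=
      (((FirstPassage.measurable_axisTime n).div_const _).sub_const _).aestronglyMeasurable
    rw [← eLpNorm_comp_measurePreserving hm hX]
    refine eLpNorm_congr_ae ?_
    filter_upwards [heq] with ω hω
    simp only [Function.comp, hω n]
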